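/- Fix an integer $e\ge 2$. For a partition $\lambda=(\lambda_1\ge\lambda_2\ge\cdots)$ let $\beta(\lambda)=\{\lambda_i-i\mid i\ge 1\}\subset\mathbb{Z}$ be its set of $\beta$-numbers (beads); runner $j$ is the set of integers congruent to $j$ modulo $e$. For $b\in\mathbb{Z}$ let $\operatorname{wt}_\lambda(b)$ be the number of $x<b$ with $x\equiv b \pmod e$ and $x\notin\beta(\lambda)$. The $e$-weight of $\lambda$ is $w=\sum_{b\in\beta(\lambda)}\operatorname{wt}_\lambda(b)$. The $e$-core of $\lambda$ is the partition whose set of $\beta$-numbers is $\{b-e\operatorname{wt}_\lambda(b)\mid b\in\beta(\lambda)\}$. The $e$-quotient of $\lambda$ is $(\lambda^{(0)},\dots,\lambda^{(e-1)})$, where the parts of $\lambda^{(j)}$ are the positive numbers $\operatorname{wt}_\lambda(b)$ for $b\in\beta(\lambda)$, $b\equiv j\pmod e$. A block $B$ of $e$-weight $w$ is the set of all partitions with a given $e$-core and $e$-weight $w$. A partition $\lambda$ is a hook-quotient partition if every $\lambda^{(j)}$ is a hook, i.e. has second part at most $1$ (the empty partition being allowed). Let $\lambda$ have $e$-weight $w$.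 Its bead movements are the $w$ pairs $(b;q)$ with $b\in\beta(\lambda)$ and $q=b-ie$, $0\le i<\operatorname{wt}_\lambda(b)$. List them as $(b_1;q_1)<\dots<(b_w;q_w)$, where $(b;q)<(b';q')$ iff $q<q'$, or $q=q'$ and $b<b'$. Let $\mathbf{z}(\lambda)\in\mathbb{Z}^w$ be the vector with $i$-th coordinate $|(q_i-e,q_i]\setminus\beta(\lambda)|$, where $(q_i-e,q_i]$ is an interval of integers. Let $\lambda$ be a hook-quotient partition of $e$-weight $w$, and let $\mathbf{e}_1,\dots,\mathbf{e}_w$ be the standard basis of $\mathbb{Z}^w$. For a residue class $j$ modulo $e$ let $\{i\mid q_i\equiv j \pmod e\}=\{i_1<\dots<i_r\}$; if $r\ge 1$, let $l=\min\{s\mid b_{i_s}=b_{i_r}\}$ and put $\epsilon^\lambda_{i_\gamma}=\mathbf{e}_{i_\gamma}-\mathbf{e}_{i_{\gamma+1}}$ for $\gamma<l$, $\epsilon^\lambda_{i_l}=\mathbf{e}_{i_l}$, and $\epsilon^\lambda_{i_\gamma}=\mathbf{e}_{i_\gamma}-\mathbf{e}_{i_{\gamma-1}}$ for $\gamma>l$.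 Doing this for all $j$ defines $\epsilon^\lambda_1,\dots,\epsilon^\lambda_w$. For $\Gamma\subseteq\{1,\dots,w\}$ put $\epsilon^\lambda_\Gamma=\sum_{a\in\Gamma}\epsilon^\lambda_a$. The parallelotope of $\lambda$ is the finite set $$\Pi(\lambda)=\{\mathbf{z}(\lambda)+\epsilon^\lambda_\Gamma\mid \Gamma\subseteq\{1,\dots,w\}\}\subset\mathbb{Z}^w .$$ A face of $\Pi(\lambda)$ is either the empty set or a set of the form $\{\mathbf{z}(\lambda)+\epsilon^\lambda_\Gamma\mid \Gamma_1\subseteq\Gamma\subseteq\{1,\dots,w\}\setminus\Gamma_0\}$ with $\Gamma_0,\Gamma_1$ disjoint subsets of $\{1,\dots,w\}$. For $m\in\mathbb{Z}$, a vector $x\in\mathbb{Z}^w$ is $m$-increasing if $x_{i+1}-x_i\ge m$ for all $1\le i<w$; for $\Omega\subseteq\mathbb{Z}^w$ let $\Omega_{\ge m}$ be the set of $m$-increasing elements of $\Omega$. A partition $\lambda$ is $m$-increasing if $\mathbf{z}(\lambda)$ is. **Proposition.** Let $\lambda$ and $\mu$ be hook-quotient partitions in a block $B$ of $e$-weight $w$.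 Then there is a set $F$ that is both a face of $\Pi(\lambda)$ and a face of $\Pi(\mu)$ such that $$\Pi(\lambda)_{\ge 4}\cap\Pi(\mu)_{\ge 4}=F_{\ge 4}.$$ In particular, if $\lambda$ or $\mu$ is $7$-increasing, then $\Pi(\lambda)\cap\Pi(\mu)$ is a face of $\Pi(\lambda)$ and a face of $\Pi(\mu)$. -/

import Mathlib

namespace Abacus

/-!  Partitions are Young diagrams: the part `lam_{i+1}` of `lam` is `lam.rowLen i`. -/

/-- The set of beta-numbers `{lam_1 - 1, lam_2 - 2, ...}` of a partition, i.e. the positions occupied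
by beads on its abacus. Runner `r` of the abacus consists of the integers congruent to `r` mod `e`. -/
def beta (lam : YoungDiagram) : Set ℤ :=
  {x | ∃ i : ℕ, x = (lam.rowLen i : ℤ) - ((i : ℤ) + 1)}

/-- The number of unoccupied positions above `b` on the runner of `b`. For a bead `b` this is the
`e`-weight of `b`. -/
noncomputable def wt (e : ℕ) (lam : YoungDiagram) (b : ℤ) : ℕ :=
  Set.ncard {x : ℤ | x < b ∧ x ≡ b [ZMOD e] ∧ x ∉ beta lam}

/-- The `e`-weight of a partition: the sum of the weights of its beads (a sum with finite support,
by `finite_movable`). -/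
noncomputable def eWeight (e : ℕ) (lam : YoungDiagram) : ℕ :=
  ∑ᶠ b ∈ beta lam, wt e lam b

/-- `kap` is the `e`-core of `lam`: its abacus is obtained from that of `lam` by sliding each bead `b`
as high up its runner as possible, that is, by `wt b` positions. -/
def IsCoreOf (e : ℕ) (kap lam : YoungDiagram) : Prop :=
  beta kap = (fun b : ℤ => b - (wt e lam b : ℤ) * (e : ℤ)) '' beta lam

/-- The block of partitions with `e`-core `kap` and `e`-weight `w`. -/
def block (e : ℕ) (kap : YoungDiagram) (w : ℕ) : Set YoungDiagram :=
  {lam | IsCoreOf e kap lam ∧ eWeight e lam = w}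

lemma mem_beta_of_lt (lam : YoungDiagram) {x : ℤ} (hx : x < -(lam.colLen 0 : ℤ)) :
    x ∈ beta lam := by
  refine ⟨(-x - 1).toNat, ?_⟩
  have h1 : ((-x - 1).toNat : ℤ) = -x - 1 := Int.toNat_of_nonneg (by omega)
  have h2 : lam.rowLen (-x - 1).toNat = 0 := by
    by_contra h
    have h3 : ((-x - 1).toNat, 0) ∈ lam := YoungDiagram.mem_iff_lt_rowLen.2 (Nat.pos_of_ne_zero h)
    have h4 := YoungDiagram.mem_iff_lt_colLen.1 h3
    omega
  rw [h2, h1]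
  simp

lemma le_of_mem_beta (lam : YoungDiagram) {x : ℤ} (hx : x ∈ beta lam) :
    x ≤ (lam.rowLen 0 : ℤ) - 1 := by
  obtain ⟨i, rfl⟩ := hx
  have := lam.rowLen_anti 0 i (Nat.zero_le i)
  omega

lemma wt_eq_zero_of_lt (e : ℕ) (lam : YoungDiagram) {b : ℤ} (hb : b < -(lam.colLen 0 : ℤ)) :
    wt e lam b = 0 := by
  have h : {x : ℤ | x < b ∧ x ≡ b [ZMOD e] ∧ x ∉ beta lam} = ∅ := by
    ext x
    simp only [Set.mem_ofPred_eq, Set.mem_empty_iff_false, iff_false]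
    rintro ⟨h1, -, h3⟩
    exact h3 (mem_beta_of_lt lam (by omega))
  rw [wt, h, Set.ncard_empty]

/-- Only finitely many beads have positive weight. -/
lemma finite_movable (e : ℕ) (lam : YoungDiagram) :
    {b : ℤ | b ∈ beta lam ∧ 0 < wt e lam b}.Finite := by
  refine (Set.finite_Icc (-(lam.colLen 0 : ℤ)) ((lam.rowLen 0 : ℤ) - 1)).subset ?_
  rintro b ⟨h1, h2⟩
  refine ⟨?_, le_of_mem_beta lam h1⟩
  by_contra h
  have := wt_eq_zero_of_lt e lam (not_le.1 h)
  omega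

/-- The beads that are not yet as high up their runner as possible. -/
noncomputable def movableBeads (e : ℕ) (lam : YoungDiagram) : Finset ℤ :=
  (finite_movable e lam).toFinset

open Classical in
/-- The component of the `e`-quotient of `lam` read off from runner `r`: its parts are the positive
weights of the beads on runner `r`, in weakly decreasing order. -/
noncomputable def eQuotient (e : ℕ) (lam : YoungDiagram) (r : ℤ) : YoungDiagram :=
  YoungDiagram.ofRowLens
    ((((movableBeads e lam).filter (fun b => b ≡ r [ZMOD e])).val.map (wt e lam)).sort (· ≥ ·))
    (Multiset.pairwise_sort _ _).sortedGE

/-- A hook: a partition whose second part is at most `1` (the empty partition is a hook). -/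
def IsHook (lam : YoungDiagram) : Prop := lam.rowLen 1 ≤ 1

/-- A hook-quotient partition: all components of the `e`-quotient are hooks. -/
def IsHookQuotient (e : ℕ) (lam : YoungDiagram) : Prop :=
  ∀ r : ℕ, r < e → IsHook (eQuotient e lam r)

open Classical in
/-- The set of bead movements. The movement `(b; q)` with `q = b - i e`, `0 ≤ i < wt b`, of the bead
`b` from `q` to `q - e` is recorded as the pair (start `q`, bead `b`), so that the lexicographic order
compares starting positions first and beads second. -/
noncomputable def beadMovements (e : ℕ) (lam : YoungDiagram) : Finset (ℤ ×ₗ ℤ) :=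
  (movableBeads e lam).biUnion fun b =>
    (Finset.range (wt e lam b)).image fun i : ℕ => toLex (b - (i : ℤ) * (e : ℤ), b)

/-- Membership in the set of bead movements, in terms of all beads. -/
lemma mem_beadMovements (e : ℕ) (lam : YoungDiagram) (q b : ℤ) :
    toLex (q, b) ∈ beadMovements e lam ↔
      b ∈ beta lam ∧ ∃ i : ℕ, i < wt e lam b ∧ q = b - (i : ℤ) * (e : ℤ) := by
  simp only [beadMovements, movableBeads, Finset.mem_biUnion, Set.Finite.mem_toFinset,
    Set.mem_ofPred_eq, Finset.mem_image, Finset.mem_range, EmbeddingLike.apply_eq_iff_eq,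
    Prod.mk.injEq]
  constructor
  · rintro ⟨b', ⟨h1, -⟩, i, h3, h4, rfl⟩
    exact ⟨h1, i, h3, h4.symm⟩
  · rintro ⟨h1, i, h3, h4⟩
    exact ⟨b, ⟨h1, by omega⟩, i, h3, h4.symm, rfl⟩

/-- The number of bead movements is the `e`-weight. -/
lemma card_beadMovements (e : ℕ) (lam : YoungDiagram) :
    (beadMovements e lam).card = eWeight e lam := by
  classical
  have h0 : ∀ b, wt 0 lam b = 0 := by
    intro b
    have h : {x : ℤ | x < b ∧ x ≡ b [ZMOD ((0 : ℕ) : ℤ)] ∧ x ∉ beta lam} = ∅ := by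
      ext x
      simp only [Set.mem_ofPred_eq, Set.mem_empty_iff_false, iff_false]
      rintro ⟨h1, h2, -⟩
      have : x = b := by simpa [Int.modEq_zero_iff] using h2
      omega
    rw [wt, h, Set.ncard_empty]
  rw [beadMovements, Finset.card_biUnion]
  · rw [eWeight, finsum_mem_eq_sum_of_inter_support_eq (t := movableBeads e lam)]
    · refine Finset.sum_congr rfl fun b _ => ?_
      rw [Finset.card_image_of_injOn, Finset.card_range]
      intro i hi j hj hij
      have hi' : i < wt e lam b := by simpa using hi
      have he : e ≠ 0 := by
        rintro rfl
        rw [h0] at hi'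
        omega
      have h := congrArg (fun p : ℤ ×ₗ ℤ => (ofLex p).1) hij
      simp only [ofLex_toLex, sub_right_inj] at h
      have he' : (e : ℤ) ≠ 0 := by exact_mod_cast he
      exact_mod_cast mul_right_cancel₀ he' h
    · ext b
      simp only [movableBeads, Set.mem_inter_iff, Function.mem_support, Set.Finite.coe_toFinset,
        Set.mem_ofPred_eq]
      constructor
      · rintro ⟨h1, h2⟩
        exact ⟨⟨h1, by omega⟩, h2⟩
      · rintro ⟨⟨h1, -⟩, h2⟩
        exact ⟨h1, h2⟩
  · intro b _ c _ hbc
    rw [Function.onFun, Finset.disjoint_left]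
    intro p hp hp'
    simp only [Finset.mem_image, Finset.mem_range] at hp hp'
    obtain ⟨i, -, rfl⟩ := hp
    obtain ⟨j, -, h⟩ := hp'
    have h := congrArg (fun p : ℤ ×ₗ ℤ => (ofLex p).2) h
    exact hbc h.symm

section Labels

variable {e w : ℕ} {lam : YoungDiagram}

/-- The bead movements `(b_1; q_1) < ... < (b_w; q_w)` of a partition of `e`-weight `w`, listed in
increasing order and indexed by `Fin w`. -/
noncomputable def movement (hw : eWeight e lam = w) : Fin w ↪o ℤ ×ₗ ℤ :=
  (beadMovements e lam).orderEmbOfFin ((card_beadMovements e lam).trans hw)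

/-- The starting position `q_i` of the `i`-th bead movement. -/
noncomputable def start (hw : eWeight e lam = w) (i : Fin w) : ℤ := (ofLex (movement hw i)).1

/-- The bead `b_i` of the `i`-th bead movement. -/
noncomputable def bead (hw : eWeight e lam = w) (i : Fin w) : ℤ := (ofLex (movement hw i)).2

/-- For a set `S` of integers, the number of elements of `(x - e, x]` that are not in `S`. -/
noncomputable def armCount (e : ℕ) (S : Set ℤ) (x : ℤ) : ℕ :=
  (Set.Ioc (x - (e : ℤ)) x \ S).ncard

/-- The label `z(lam)`, a vector of integers of length `w`. -/
noncomputable def zLabel (hw : eWeight e lam = w) : Fin w → ℤ :=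
  fun i => (armCount e (beta lam) (start hw i) : ℤ)

open Classical in
/-- The indices of the bead movements on the same runner as the `i`-th one. -/
noncomputable def runnerIdx (hw : eWeight e lam = w) (i : Fin w) : Finset (Fin w) :=
  Finset.univ.filter fun k => start hw k ≡ start hw i [ZMOD e]

lemma runnerIdx_nonempty (hw : eWeight e lam = w) (i : Fin w) : (runnerIdx hw i).Nonempty :=
  ⟨i, by simp [runnerIdx]⟩

/-- The last bead movement `i_r` on the runner of the `i`-th one. -/
noncomputable def lastIdx (hw : eWeight e lam = w) (i : Fin w) : Fin w :=
  (runnerIdx hw i).max' (runnerIdx_nonempty hw i)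

lemma pivot_nonempty (hw : eWeight e lam = w) (i : Fin w) :
    ((runnerIdx hw i).filter fun k => bead hw k = bead hw (lastIdx hw i)).Nonempty :=
  ⟨lastIdx hw i, Finset.mem_filter.2 ⟨Finset.max'_mem _ _, rfl⟩⟩

/-- The index `i_l` of the final bead movement of the bottom bead on the runner of the `i`-th bead
movement: the first movement on this runner that has the same bead as the last one. -/
noncomputable def pivot (hw : eWeight e lam = w) (i : Fin w) : Fin w :=
  ((runnerIdx hw i).filter fun k => bead hw k = bead hw (lastIdx hw i)).min' (pivot_nonempty hw i)

lemma pivot_mem (hw : eWeight e lam = w) (i : Fin w) : pivot hw i ∈ runnerIdx hw i :=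
  (Finset.mem_filter.1 (Finset.min'_mem _ (pivot_nonempty hw i))).1

/-- The modified basis vectors: `e_i - e_{i+}` if `i` precedes the pivot of its runner, `e_i` if `i`
is the pivot, and `e_i - e_{i-}` if `i` comes after the pivot, where `i+` and `i-` are the next and the
previous index on the same runner. -/
noncomputable def epsVec (hw : eWeight e lam = w) (i : Fin w) : Fin w → ℤ :=
  if h : i < pivot hw i then
    Pi.single i 1 - Pi.single (((runnerIdx hw i).filter fun k => i < k).min'
      ⟨pivot hw i, Finset.mem_filter.2 ⟨pivot_mem hw i, h⟩⟩) 1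
  else if h' : pivot hw i < i then
    Pi.single i 1 - Pi.single (((runnerIdx hw i).filter fun k => k < i).max'
      ⟨pivot hw i, Finset.mem_filter.2 ⟨pivot_mem hw i, h'⟩⟩) 1
  else Pi.single i 1

/-- The point `z(lam) + eps_Gamma` of the parallelotope. -/
noncomputable def vertex (hw : eWeight e lam = w) (G : Finset (Fin w)) : Fin w → ℤ :=
  zLabel hw + ∑ a ∈ G, epsVec hw a

/-- The parallelotope `Pi(lam)`, a finite subset of `ℤ^w`. -/
def parallelotope (hw : eWeight e lam = w) : Set (Fin w → ℤ) :=
  {x | ∃ G : Finset (Fin w), x = vertex hw G}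

/-- Faces of the parallelotope `Pi(lam)`: the empty set, and the sets of all `z(lam) + eps_Gamma` with
`G1 ⊆ Gamma` and `Gamma` disjoint from `G0`, for disjoint `G0`, `G1`. -/
def IsFace (hw : eWeight e lam = w) (F : Set (Fin w → ℤ)) : Prop :=
  F = ∅ ∨ ∃ G0 G1 : Finset (Fin w), Disjoint G0 G1 ∧
    F = {x | ∃ G : Finset (Fin w), G1 ⊆ G ∧ G ⊆ G0ᶜ ∧ x = vertex hw G}

end Labels

/-- A vector is `m`-increasing if each coordinate exceeds the previous one by at least `m`. -/
def IsIncreasing {w : ℕ} (m : ℤ) (x : Fin w → ℤ) : Prop :=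
  ∀ i j : Fin w, (j : ℕ) = (i : ℕ) + 1 → m ≤ x j - x i

/-- The set of `m`-increasing elements of a subset of `ℤ^w`. -/
def incPart {w : ℕ} (m : ℤ) (S : Set (Fin w → ℤ)) : Set (Fin w → ℤ) :=
  {x | x ∈ S ∧ IsIncreasing m x}

end Abacus

/-! Let `q` be the vector of starting positions of a hook-quotient partition. The parallelotope of
the partition is the vertex set of the subdifferential at `q` of a convex piecewise linear function
`f` that depends only on the block: `f` is the sum of `max (v, 0)` over the affine forms `v = q_i -
d`, for `d` the first vacancy of a runner of the core, and `v = q_i - q_j + e`, for `i < j`. A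
subgradient that is a vertex is the sum of the linear parts over a selection: all forms positive at
`q`, none that are negative, and any of those that vanish.

Two facts give this description. Distinct movements start at distinct positions
(`IsHookQuotient.bead_unique`), so the vacancies, and hence the label, can be computed from `q` and
the core (`vacant_indicator`, `zLabel_eq`, `zLabel_eq_sum_baseSel`). On each runner the starting
positions form an unbroken string around the first vacancy of the core, so exactly `w` forms vanish
at `q`, and up to sign their linear parts are the vectors `epsVec`, which are linearly independent
(`exists_isFrame`).

Subdifferentials of a convex function are monotone. If selections at two points have the same sum,
they differ only in forms vanishing at both points (`IsSelection.mem_iff_or`); by independence they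
can then be taken equal (`IsFrame.inter_eq`). Common selections are cut out by prescribing some of
the vanishing forms, which describes a face (`IsFrame.isFace_common`). Thus the whole intersection
of the two parallelotopes is a face of each. -/

namespace Abacus

/-! ### Runners, cores and bead movements -/

section Runners

variable {e : ℕ} {lam kap : YoungDiagram}

lemma le_of_modEq_of_lt_add {x y : ℤ} (h : x ≡ y [ZMOD e]) (hlt : x < y + e) : x ≤ y := by
  obtain ⟨k, hk⟩ := Int.modEq_iff_dvd.1 h
  have : 0 ≤ k := by
    by_contra hneg
    have h1 : k ≤ -1 := by omega
    have h2 : (e : ℤ) * k ≤ e * (-1) := mul_le_mul_of_nonneg_left h1 (Int.natCast_nonneg e)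
    omega
  have : 0 ≤ (e : ℤ) * k := by positivity
  omega

lemma add_le_of_modEq_of_lt {x y : ℤ} (h : x ≡ y [ZMOD e]) (hlt : x < y) : x + e ≤ y := by
  by_contra hc
  have := le_of_modEq_of_lt_add h.symm (not_le.1 hc)
  omega

lemma sub_self_modEq (x : ℤ) : x - e ≡ x [ZMOD e] := by
  simp [Int.ModEq]

lemma add_self_modEq (x : ℤ) : x + e ≡ x [ZMOD e] := by
  simp [Int.ModEq]

lemma exists_nat_of_modEq_of_le (he : 0 < e) {x y : ℤ} (h : x ≡ y [ZMOD e]) (hle : x ≤ y) :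
    ∃ n : ℕ, y = x + n * e := by
  obtain ⟨k, hk⟩ := Int.modEq_iff_dvd.1 h
  have : 0 ≤ k := by
    by_contra hneg
    have h1 : k ≤ -1 := by omega
    have h2 : (e : ℤ) * k ≤ e * (-1) := mul_le_mul_of_nonneg_left h1 (Int.natCast_nonneg e)
    omega
  refine ⟨k.toNat, ?_⟩
  rw [Int.toNat_of_nonneg this]
  linarith [mul_comm k (e : ℤ)]

lemma finite_vacant_above (e : ℕ) (lam : YoungDiagram) (b : ℤ) :
    {x : ℤ | x < b ∧ x ≡ b [ZMOD e] ∧ x ∉ beta lam}.Finite := by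
  refine (Set.finite_Ico (-(lam.colLen 0 : ℤ)) b).subset ?_
  rintro x ⟨h1, -, h3⟩
  refine ⟨?_, h1⟩
  by_contra h
  exact h3 (mem_beta_of_lt lam (not_le.1 h))

lemma wt_add_of_mem (he : 0 < e) {y : ℤ} (hy : y ∈ beta lam) :
    wt e lam (y + e) = wt e lam y := by
  unfold wt
  congr 1
  ext x
  simp only [Set.mem_ofPred_eq]
  constructor
  · rintro ⟨h1, h2, h3⟩
    have h2' := h2.trans (add_self_modEq y)
    have := le_of_modEq_of_lt_add h2' h1
    exact ⟨lt_of_le_of_ne this fun h => h3 (h ▸ hy), h2', h3⟩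
  · rintro ⟨h1, h2, h3⟩
    exact ⟨by omega, h2.trans (add_self_modEq y).symm, h3⟩

lemma wt_add_of_notMem (he : 0 < e) {y : ℤ} (hy : y ∉ beta lam) :
    wt e lam (y + e) = wt e lam y + 1 := by
  have h : {x : ℤ | x < y + e ∧ x ≡ y + e [ZMOD e] ∧ x ∉ beta lam} =
      insert y {x : ℤ | x < y ∧ x ≡ y [ZMOD e] ∧ x ∉ beta lam} := by
    ext x
    simp only [Set.mem_ofPred_eq, Set.mem_insert_iff]
    constructor
    · rintro ⟨h1, h2, h3⟩
      have h2' := h2.trans (add_self_modEq y)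
      rcases (le_of_modEq_of_lt_add h2' h1).eq_or_lt with h | h
      · exact Or.inl h
      · exact Or.inr ⟨h, h2', h3⟩
    · rintro (rfl | ⟨h1, h2, h3⟩)
      · exact ⟨by omega, (add_self_modEq x).symm, hy⟩
      · exact ⟨by omega, h2.trans (add_self_modEq y).symm, h3⟩
  rw [wt, h, Set.ncard_insert_of_notMem (by simp) (finite_vacant_above e lam y), wt]

/-- The position to which `y` slides when its runner is pushed up. -/
noncomputable def corePos (e : ℕ) (lam : YoungDiagram) (y : ℤ) : ℤ := y - (wt e lam y : ℤ) * e

/-- Along a runner the core position advances by `e` after a bead and stays put after a vacancy.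
Hence it is monotone, and strictly so on beads: sliding up preserves their order. -/
lemma corePos_add_of_mem (he : 0 < e) {y : ℤ} (hy : y ∈ beta lam) :
    corePos e lam (y + e) = corePos e lam y + e := by
  rw [corePos, corePos, wt_add_of_mem he hy]
  ring

lemma corePos_add_of_notMem (he : 0 < e) {y : ℤ} (hy : y ∉ beta lam) :
    corePos e lam (y + e) = corePos e lam y := by
  rw [corePos, corePos, wt_add_of_notMem he hy]
  push_cast
  ring

lemma corePos_modEq (y : ℤ) : corePos e lam y ≡ y [ZMOD e] := by
  simp [corePos, Int.modEq_iff_dvd]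

lemma corePos_le (y : ℤ) : corePos e lam y ≤ y := by
  have : 0 ≤ (wt e lam y : ℤ) * e := by positivity
  rw [corePos]
  omega

lemma corePos_mono (he : 0 < e) {x y : ℤ} (h : x ≡ y [ZMOD e]) (hle : x ≤ y) :
    corePos e lam x ≤ corePos e lam y := by
  obtain ⟨n, rfl⟩ := exists_nat_of_modEq_of_le he h hle
  clear h hle
  induction n with
  | zero => simp
  | succ n ih =>
    have h1 : x + ((n + 1 : ℕ) : ℤ) * e = x + n * e + e := by push_cast; ring
    rw [h1]
    by_cases hb : x + n * e ∈ beta lam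
    · rw [corePos_add_of_mem he hb]
      omega
    · rwa [corePos_add_of_notMem he hb]

lemma corePos_lt (he : 0 < e) {x y : ℤ} (h : x ≡ y [ZMOD e]) (hlt : x < y) (hx : x ∈ beta lam) :
    corePos e lam x < corePos e lam y := by
  have h1 := corePos_add_of_mem (lam := lam) he hx
  have h2 := corePos_mono (lam := lam) he ((add_self_modEq x).trans h) (add_le_of_modEq_of_lt h hlt)
  omega

lemma mem_beta_core_iff (hcore : IsCoreOf e kap lam) {x : ℤ} :
    x ∈ beta kap ↔ ∃ b ∈ beta lam, corePos e lam b = x := by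
  rw [hcore]
  rfl

/-- Going up the runner from `y`, vacancies leave the core position unchanged, and the first bead
met slides to one step above it. A bead is met because all sufficiently small integers are beads.
Runners of the core therefore have no gaps. -/
lemma corePos_sub_mem_core (he : 0 < e) (hcore : IsCoreOf e kap lam) (y : ℤ) :
    corePos e lam y - e ∈ beta kap := by
  obtain ⟨n, hn⟩ : ∃ n : ℕ, y ≤ -(lam.colLen 0 : ℤ) + n :=
    ⟨(y + lam.colLen 0).toNat, by have := Int.self_le_toNat (y + lam.colLen 0); omega⟩
  induction n generalizing y with
  | zero =>
    have hb : y - e ∈ beta lam := mem_beta_of_lt lam (by omega)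
    have := corePos_add_of_mem he hb
    rw [sub_add_cancel] at this
    exact (mem_beta_core_iff hcore).2 ⟨_, hb, by omega⟩
  | succ n ih =>
    by_cases hb : y - e ∈ beta lam
    · have := corePos_add_of_mem he hb
      rw [sub_add_cancel] at this
      exact (mem_beta_core_iff hcore).2 ⟨_, hb, by omega⟩
    · have := corePos_add_of_notMem he hb
      rw [sub_add_cancel] at this
      rw [this]
      exact ih (y - e) (by push_cast at hn; omega)

lemma sub_mem_core (he : 0 < e) (hcore : IsCoreOf e kap lam) {x : ℤ} (hx : x ∈ beta kap) :
    x - e ∈ beta kap := by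
  obtain ⟨b, -, rfl⟩ := (mem_beta_core_iff hcore).1 hx
  exact corePos_sub_mem_core he hcore b

lemma mem_core_of_le (he : 0 < e) (hcore : IsCoreOf e kap lam) {x y : ℤ} (hx : x ∈ beta kap)
    (h : y ≡ x [ZMOD e]) (hle : y ≤ x) : y ∈ beta kap := by
  obtain ⟨n, rfl⟩ := exists_nat_of_modEq_of_le he h hle
  clear h hle
  induction n with
  | zero => simpa using hx
  | succ n ih =>
    refine ih ?_
    have := sub_mem_core he hcore hx
    rwa [show y + ((n + 1 : ℕ) : ℤ) * e - e = y + n * e by push_cast; ring] at this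

/-- Since `corePos b = b - wt b * e`, the condition `i < wt b` says that `b - i * e` lies beyond the
core position. The starts become an interval of the runner, and no weights need to be counted. -/
lemma mem_beadMovements_iff (he : 0 < e) {q b : ℤ} :
    toLex (q, b) ∈ beadMovements e lam ↔
      b ∈ beta lam ∧ q ≡ b [ZMOD e] ∧ q ≤ b ∧ corePos e lam b < q := by
  have he' : (0 : ℤ) < e := by exact_mod_cast he
  rw [mem_beadMovements]
  refine and_congr_right fun _ => ?_
  constructor
  · rintro ⟨i, hi, rfl⟩
    refine ⟨by simp [Int.modEq_iff_dvd], ?_, ?_⟩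
    · have : 0 ≤ (i : ℤ) * e := by positivity
      omega
    · have h1 : (i : ℤ) < wt e lam b := by exact_mod_cast hi
      have := mul_lt_mul_of_pos_right h1 he'
      rw [corePos]
      omega
  · rintro ⟨h1, h2, h3⟩
    obtain ⟨n, hn⟩ := exists_nat_of_modEq_of_le he h1 h2
    refine ⟨n, ?_, by omega⟩
    have h4 : (n : ℤ) * e < wt e lam b * e := by
      rw [corePos] at h3
      omega
    exact_mod_cast lt_of_mul_lt_mul_right h4 he'.le

/-- Counting parts of size at least two does not depend on their order, so the hook condition can be
tested on the multiset of weights of a runner. -/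
lemma length_filter_two_le_of_isHook : ∀ {l : List ℕ} (hl : l.SortedGE),
    IsHook (YoungDiagram.ofRowLens l hl) → (l.filter (2 ≤ ·)).length ≤ 1
  | [], _, _ => by simp
  | [x], _, _ => List.length_filter_le (2 ≤ ·) [x]
  | x :: y :: t, hl, h => by
    have hy : y ≤ 1 := by
      refine le_trans (le_of_eq ?_) h
      exact (YoungDiagram.rowLen_ofRowLens (w := x :: y :: t) (hw := hl) ⟨1, by simp⟩).symm
    have hz : ∀ z ∈ y :: t, ¬ 2 ≤ z := by
      intro z hz
      rcases List.mem_cons.1 hz with rfl | hz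
      · omega
      · have := List.rel_of_pairwise_cons hl.pairwise.of_cons hz
        omega
    have hnil : (y :: t).filter (2 ≤ ·) = [] :=
      List.filter_eq_nil_iff.2 fun z h => by simpa using hz z h
    rw [List.filter_cons]
    split_ifs <;> simp [hnil]

/-- On each runner of a hook-quotient partition, at most one bead has weight at least two. -/
lemma IsHookQuotient.eq_of_two_le_wt (he : 0 < e) (hook : IsHookQuotient e lam) {b c : ℤ}
    (hb : b ∈ beta lam) (hc : c ∈ beta lam) (hbc : b ≡ c [ZMOD e]) (hwb : 2 ≤ wt e lam b)
    (hwc : 2 ≤ wt e lam c) : b = c := by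
  classical
  by_contra hne
  have he' : (e : ℤ) ≠ 0 := by exact_mod_cast he.ne'
  have hr0 := Int.emod_nonneg b he'
  have hr1 : b % e < e := Int.emod_lt_of_pos b (by exact_mod_cast he)
  have h := hook (b % e).toNat (by omega)
  have hcast : ((b % e).toNat : ℤ) = b % e := Int.toNat_of_nonneg hr0
  have hbr : b ≡ ((b % e).toNat : ℤ) [ZMOD e] := by
    rw [hcast]
    exact (Int.mod_modEq b e).symm
  rw [IsHook, eQuotient, hcast] at h
  rw [hcast] at hbr
  set M : Multiset ℕ :=
    ((movableBeads e lam).filter (fun x => x ≡ b % e [ZMOD e])).val.map (wt e lam) with hM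
  set l := M.sort (· ≥ ·) with hl
  -- The weights may coincide, so an inclusion of multisets is needed: distinct beads contribute
  -- separate parts.
  have hle : ({wt e lam b, wt e lam c} : Multiset ℕ) ≤ M := by
    have hsub : ({b, c} : Finset ℤ) ⊆ (movableBeads e lam).filter (fun x => x ≡ b % e [ZMOD e]) := by
      intro x hx
      rcases Finset.mem_insert.1 hx with rfl | hx
      · exact Finset.mem_filter.2 ⟨(finite_movable e lam).mem_toFinset.2 ⟨hb, by omega⟩, hbr⟩
      · rw [Finset.mem_singleton.1 hx]
        exact Finset.mem_filter.2
          ⟨(finite_movable e lam).mem_toFinset.2 ⟨hc, by omega⟩, hbc.symm.trans hbr⟩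
    have := Multiset.map_le_map (f := wt e lam) (Finset.val_le_iff.2 hsub)
    rwa [Finset.insert_val_of_notMem (by simpa using hne), Finset.singleton_val,
      Multiset.map_cons, Multiset.map_singleton] at this
  have hMl : (l : Multiset ℕ) = M := Multiset.sort_eq _ _
  have := length_filter_two_le_of_isHook _ h
  rw [← hMl] at hle
  have h1 := Multiset.card_le_card (Multiset.filter_le_filter (2 ≤ ·) hle)
  have h2 : 2 ≤ (l.filter (2 ≤ ·)).length := by
    simpa [Multiset.filter_cons_of_pos, Multiset.filter_singleton, hwb, hwc] using h1
  exact absurd (h2.trans (le_of_eq_of_le (by congr!) this)) (by norm_num)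

/-- Distinct bead movements of a hook-quotient partition have distinct starting positions. -/
lemma IsHookQuotient.bead_unique (he : 0 < e) (hook : IsHookQuotient e lam) {q b c : ℤ}
    (hb : toLex (q, b) ∈ beadMovements e lam) (hc : toLex (q, c) ∈ beadMovements e lam) :
    b = c := by
  have he' : (0 : ℤ) < e := by exact_mod_cast he
  have key : ∀ {b c : ℤ}, toLex (q, b) ∈ beadMovements e lam →
      toLex (q, c) ∈ beadMovements e lam → ¬ b < c := by
    intro b c hb hc hlt
    obtain ⟨hb1, hb2, hb3, hb4⟩ := (mem_beadMovements_iff he).1 hb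
    obtain ⟨hc1, hc2, hc3, hc4⟩ := (mem_beadMovements_iff he).1 hc
    have hbc := hb2.symm.trans hc2
    -- On the runner, `corePos b < corePos c < q ≤ b < c`, so each bead is at least two steps away
    -- from its core position.
    have h1 := corePos_lt he hbc hlt hb1
    have h2 := add_le_of_modEq_of_lt ((corePos_modEq c).trans hc2.symm) hc4
    have h3 := add_le_of_modEq_of_lt
      ((corePos_modEq b).trans (hbc.trans (corePos_modEq c).symm)) h1
    have h4 := add_le_of_modEq_of_lt hbc hlt
    have two : ∀ x : ℤ, corePos e lam x + e + e ≤ x → 2 ≤ wt e lam x := by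
      intro x hx
      rw [corePos] at hx
      have : (2 : ℤ) * e ≤ wt e lam x * e := by linarith
      exact_mod_cast le_of_mul_le_mul_right this he'
    exact hlt.ne (hook.eq_of_two_le_wt he hb1 hc1 hbc (two b (by omega)) (two c (by omega)))
  exact le_antisymm (not_lt.1 (key hc hb)) (not_lt.1 (key hb hc))

end Runners

/-! ### Starting positions, vacancies and edge vectors -/

section Labels

variable {e w : ℕ} {lam kap : YoungDiagram}

lemma movement_mem (hw : eWeight e lam = w) (i : Fin w) :
    toLex (start hw i, bead hw i) ∈ beadMovements e lam :=
  Finset.orderEmbOfFin_mem _ ((card_beadMovements e lam).trans hw) i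

lemma exists_movement_eq (hw : eWeight e lam = w) {q b : ℤ}
    (h : toLex (q, b) ∈ beadMovements e lam) : ∃ i, start hw i = q ∧ bead hw i = b := by
  have h1 : toLex (q, b) ∈ Set.range (movement hw) := by
    rw [movement, Finset.range_orderEmbOfFin]
    exact h
  obtain ⟨i, hi⟩ := h1
  exact ⟨i, by rw [start, hi]; rfl, by rw [bead, hi]; rfl⟩

lemma mem_range_start_iff (he : 0 < e) (hw : eWeight e lam = w) {q : ℤ} :
    q ∈ Set.range (start hw) ↔
      ∃ b ∈ beta lam, q ≡ b [ZMOD e] ∧ q ≤ b ∧ corePos e lam b < q := by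
  constructor
  · rintro ⟨i, rfl⟩
    obtain ⟨h1, h2⟩ := (mem_beadMovements_iff he).1 (movement_mem hw i)
    exact ⟨_, h1, h2⟩
  · rintro ⟨b, h1, h2⟩
    obtain ⟨i, hi, -⟩ := exists_movement_eq hw ((mem_beadMovements_iff he).2 ⟨h1, h2⟩)
    exact ⟨i, hi⟩

lemma start_strictMono (he : 0 < e) (hook : IsHookQuotient e lam) (hw : eWeight e lam = w) :
    StrictMono (start hw) := by
  intro i j hij
  have h : movement hw i < movement hw j := (movement hw).strictMono hij
  rcases Prod.Lex.lt_iff.1 h with h1 | ⟨h1, h2⟩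
  · exact h1
  · have hi := movement_mem hw i
    have hj := movement_mem hw j
    rw [← show start hw i = start hw j from h1] at hj
    exact absurd (hook.bead_unique he hi hj) (ne_of_lt h2)

open Classical in
/-- The vacancies of a hook-quotient partition, in terms of the vacancies of its core and of the
starting positions of its bead movements. -/
lemma vacant_indicator (he : 0 < e) (hook : IsHookQuotient e lam) (hcore : IsCoreOf e kap lam)
    (hw : eWeight e lam = w) (x : ℤ) :
    (if x ∉ beta lam then (1 : ℤ) else 0) = (if x ∉ beta kap then 1 else 0) +
      (if x + e ∈ Set.range (start hw) then 1 else 0) -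
      (if x ∈ Set.range (start hw) then 1 else 0) := by
  have he' : (0 : ℤ) < e := by exact_mod_cast he
  have up : ∀ {b : ℤ}, x ≡ b [ZMOD e] → x ≤ b → b ≠ x → x + e ≤ b := fun h1 h2 h3 =>
    add_le_of_modEq_of_lt h1 (lt_of_le_of_ne h2 h3.symm)
  have mem_of_core : ∀ {b : ℤ}, b ∈ beta lam → corePos e lam b = x → b ≠ x →
      x + e ∈ Set.range (start hw) := by
    intro b hb hbx hne
    have hmod : x ≡ b [ZMOD e] := by
      have := corePos_modEq (e := e) (lam := lam) b
      rwa [hbx] at this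
    have hle : x ≤ b := by
      have := corePos_le (e := e) (lam := lam) b
      rwa [hbx] at this
    exact (mem_range_start_iff he hw).2
      ⟨b, hb, (add_self_modEq x).trans hmod, up hmod hle hne, by omega⟩
  have down : x + e ∈ Set.range (start hw) → x ∉ beta kap → x ∈ Set.range (start hw) := by
    intro h hK
    obtain ⟨b, hb, h1, h2, h3⟩ := (mem_range_start_iff he hw).1 h
    refine (mem_range_start_iff he hw).2 ⟨b, hb, (add_self_modEq x).symm.trans h1, by omega, ?_⟩
    have h4 := le_of_modEq_of_lt_add ((corePos_modEq b).trans (h1.symm.trans (add_self_modEq x))) h3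
    exact lt_of_le_of_ne h4 fun h5 => hK ((mem_beta_core_iff hcore).2 ⟨b, hb, h5⟩)
  -- The identity is conservation of beads at `x`: movements starting at `x` remove a bead, those
  -- starting at `x + e` bring one, and by `bead_unique` there is at most one of each.
  by_cases hx : x ∈ beta lam
  · by_cases hc : corePos e lam x = x
    · have hK : x ∈ beta kap := (mem_beta_core_iff hcore).2 ⟨x, hx, hc⟩
      have h1 : x + e ∉ Set.range (start hw) := by
        intro h
        obtain ⟨b, -, h1, h2, h3⟩ := (mem_range_start_iff he hw).1 h
        have h1' := (add_self_modEq x).symm.trans h1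
        have h4 := corePos_lt (lam := lam) he h1' (by omega) hx
        have h5 := le_of_modEq_of_lt_add ((corePos_modEq b).trans h1'.symm) h3
        omega
      have h2 : x ∉ Set.range (start hw) := by
        intro h
        obtain ⟨b, -, h1, h2, h3⟩ := (mem_range_start_iff he hw).1 h
        have := corePos_mono (lam := lam) he h1 h2
        omega
      simp [hx, hK, h1, h2]
    · have hQ : x ∈ Set.range (start hw) := (mem_range_start_iff he hw).2
        ⟨x, hx, Int.ModEq.refl _, le_rfl, lt_of_le_of_ne (corePos_le x) hc⟩
      by_cases hK : x ∈ beta kap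
      · obtain ⟨b, hb, hbx⟩ := (mem_beta_core_iff hcore).1 hK
        have := mem_of_core hb hbx fun h => hc (h ▸ hbx)
        simp [hx, hK, hQ, this]
      · have : x + e ∉ Set.range (start hw) := by
          intro h
          obtain ⟨b, hb, h1, h2, h3⟩ := (mem_range_start_iff he hw).1 h
          have h1' := (add_self_modEq x).symm.trans h1
          have h4 := le_of_modEq_of_lt_add ((corePos_modEq b).trans h1'.symm) h3
          have h5 : corePos e lam b < x :=
            lt_of_le_of_ne h4 fun h5 => hK ((mem_beta_core_iff hcore).2 ⟨b, hb, h5⟩)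
          have := hook.bead_unique he
            ((mem_beadMovements_iff he).2 ⟨hb, h1', by omega, h5⟩)
            ((mem_beadMovements_iff he).2
              ⟨hx, Int.ModEq.refl x, le_rfl, lt_of_le_of_ne (corePos_le x) hc⟩)
          omega
        simp [hx, hK, hQ, this]
  · have hne : ∀ {b : ℤ}, b ∈ beta lam → b ≠ x := fun hb h => hx (h ▸ hb)
    by_cases hK : x ∈ beta kap
    · obtain ⟨b, hb, hbx⟩ := (mem_beta_core_iff hcore).1 hK
      have h1 := mem_of_core hb hbx (hne hb)
      have h2 : x ∉ Set.range (start hw) := by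
        intro h
        obtain ⟨c, hc, h3, h4, h5⟩ := (mem_range_start_iff he hw).1 h
        have hmod : x ≡ b [ZMOD e] := by
          have := corePos_modEq (e := e) (lam := lam) b
          rwa [hbx] at this
        have hle : x ≤ b := by
          have := corePos_le (e := e) (lam := lam) b
          rwa [hbx] at this
        have := hook.bead_unique (q := x + e) he
          ((mem_beadMovements_iff he).2
            ⟨hb, (add_self_modEq x).trans hmod, up hmod hle (hne hb), by omega⟩)
          ((mem_beadMovements_iff he).2
            ⟨hc, (add_self_modEq x).trans h3, up h3 h4 (hne hc), by omega⟩)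
        subst this
        omega
      simp [hx, hK, h1, h2]
    · have : x + e ∈ Set.range (start hw) ↔ x ∈ Set.range (start hw) := by
        refine ⟨fun h => down h hK, fun h => ?_⟩
        obtain ⟨b, hb, h1, h2, h3⟩ := (mem_range_start_iff he hw).1 h
        exact (mem_range_start_iff he hw).2
          ⟨b, hb, (add_self_modEq x).trans h1, up h1 h2 (hne hb), by omega⟩
      simp [hx, hK, this]

/-- At `x = start hw i` the left side of `vacant_indicator` is nonnegative while the last term is
`-1`, so something must compensate. With the next lemma, this shows that the neighbours `i+` and
`i-` in the definition of `epsVec` are exactly `e` away. -/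
lemma start_add_mem_range (he : 0 < e) (hook : IsHookQuotient e lam) (hcore : IsCoreOf e kap lam)
    (hw : eWeight e lam = w) {i : Fin w} (hi : start hw i ∈ beta kap) :
    ∃ j, start hw j = start hw i + e := by
  classical
  have h := vacant_indicator he hook hcore hw (start hw i)
  rw [if_neg (not_not.2 hi), if_pos (Set.mem_range_self i)] at h
  by_contra hj
  rw [if_neg (show start hw i + e ∉ Set.range (start hw) from hj)] at h
  split_ifs at h <;> omega

lemma start_sub_mem_range (he : 0 < e) (hook : IsHookQuotient e lam) (hcore : IsCoreOf e kap lam)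
    (hw : eWeight e lam = w) {i : Fin w} (hi : start hw i - e ∉ beta kap) :
    ∃ j, start hw j = start hw i - e := by
  classical
  have h := vacant_indicator he hook hcore hw (start hw i - e)
  rw [if_pos hi, sub_add_cancel, if_pos (Set.mem_range_self i)] at h
  by_contra hj
  rw [if_neg (show start hw i - e ∉ Set.range (start hw) from hj)] at h
  split_ifs at h <;> omega

lemma mem_runnerIdx (hw : eWeight e lam = w) {i k : Fin w} :
    k ∈ runnerIdx hw i ↔ start hw k ≡ start hw i [ZMOD e] := by
  simp [runnerIdx]

/-- The pivot of a runner starts at the first vacancy of the core. -/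
lemma start_pivot (he : 0 < e) (hook : IsHookQuotient e lam) (hcore : IsCoreOf e kap lam)
    (hw : eWeight e lam = w) (i : Fin w) :
    start hw (pivot hw i) ∉ beta kap ∧ start hw (pivot hw i) - e ∈ beta kap := by
  have he' : (0 : ℤ) < e := by exact_mod_cast he
  have hmono := start_strictMono he hook hw
  set L := lastIdx hw i with hL
  set b := bead hw L with hb
  have hLmem : start hw L ≡ start hw i [ZMOD e] :=
    (mem_runnerIdx hw).1 (Finset.max'_mem _ (runnerIdx_nonempty hw i))
  have hLmax : ∀ k, start hw k ≡ start hw i [ZMOD e] → start hw k ≤ start hw L := fun k hk =>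
    hmono.monotone (Finset.le_max' _ k ((mem_runnerIdx hw).2 hk))
  obtain ⟨hbβ, hLb, hLle, hLcore⟩ := (mem_beadMovements_iff he).1 (movement_mem hw L)
  rw [← hb] at hbβ hLb hLle hLcore
  have hbi : b ≡ start hw i [ZMOD e] := hLb.symm.trans hLmem
  have hpm := (Finset.mem_filter.1 (Finset.min'_mem _ (pivot_nonempty hw i))).2
  change bead hw (pivot hw i) = b at hpm
  have hp := (mem_beadMovements_iff he).1 (movement_mem hw (pivot hw i))
  rw [hpm] at hp
  obtain ⟨-, hp2, hp3, hp4⟩ := hp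
  -- The movements of the last bead `b` start at `corePos b + e, ..., b`; the pivot is the one with
  -- the smallest start.
  have hstart : start hw (pivot hw i) = corePos e lam b + e := by
    apply le_antisymm
    · have hmov : toLex (corePos e lam b + e, b) ∈ beadMovements e lam := by
        refine (mem_beadMovements_iff he).2
          ⟨hbβ, (add_self_modEq _).trans (corePos_modEq b), ?_, by omega⟩
        exact add_le_of_modEq_of_lt (corePos_modEq b) (by omega)
      obtain ⟨j, hj1, hj2⟩ := exists_movement_eq hw hmov
      rw [← hj1]
      refine hmono.monotone (Finset.min'_le _ j (Finset.mem_filter.2 ⟨?_, hj2⟩))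
      rw [mem_runnerIdx, hj1]
      exact ((add_self_modEq _).trans (corePos_modEq b)).trans hbi
    · exact add_le_of_modEq_of_lt ((corePos_modEq b).trans hp2.symm) hp4
  rw [hstart, add_sub_cancel_right]
  refine ⟨fun hK => ?_, (mem_beta_core_iff hcore).2 ⟨b, hbβ, rfl⟩⟩
  -- Otherwise a bead `c > b` slides to `corePos b + e`, and its movement starting at `c` comes
  -- after the supposedly last one.
  obtain ⟨c, hc, hcb⟩ := (mem_beta_core_iff hcore).1 hK
  have hcmod : c ≡ b [ZMOD e] := (corePos_modEq c).symm.trans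
    (hcb ▸ (add_self_modEq _).trans (corePos_modEq b))
  have hlt : b < c := by
    by_contra h
    have := corePos_mono (lam := lam) he hcmod (not_lt.1 h)
    omega
  have hcc : corePos e lam c < c := by
    have h1 : corePos e lam b < b := by omega
    have := add_le_of_modEq_of_lt (corePos_modEq b) h1
    omega
  obtain ⟨j, hj, -⟩ := exists_movement_eq hw
    ((mem_beadMovements_iff he).2 ⟨hc, Int.ModEq.refl c, le_rfl, hcc⟩)
  have := hLmax j (hj ▸ hcmod.trans hbi)
  omega

/-- Replaces comparison with the pivot, defined through the beads of `lam`, by a condition on the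
starting position and the core alone. -/
lemma lt_pivot_iff (he : 0 < e) (hook : IsHookQuotient e lam) (hcore : IsCoreOf e kap lam)
    (hw : eWeight e lam = w) (i : Fin w) : i < pivot hw i ↔ start hw i ∈ beta kap := by
  obtain ⟨h1, h2⟩ := start_pivot he hook hcore hw i
  have hmod := (mem_runnerIdx hw).1 (pivot_mem hw i)
  rw [← (start_strictMono he hook hw).lt_iff_lt]
  constructor
  · intro h
    have := add_le_of_modEq_of_lt hmod.symm h
    exact mem_core_of_le he hcore h2 (hmod.symm.trans (sub_self_modEq _).symm) (by omega)
  · intro h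
    by_contra hlt
    exact h1 (mem_core_of_le he hcore h hmod (not_lt.1 hlt))

lemma pivot_lt_iff (he : 0 < e) (hook : IsHookQuotient e lam) (hcore : IsCoreOf e kap lam)
    (hw : eWeight e lam = w) (i : Fin w) : pivot hw i < i ↔ start hw i - e ∉ beta kap := by
  obtain ⟨h1, h2⟩ := start_pivot he hook hcore hw i
  have hmod := (mem_runnerIdx hw).1 (pivot_mem hw i)
  rw [← (start_strictMono he hook hw).lt_iff_lt]
  constructor
  · intro h hK
    have := add_le_of_modEq_of_lt hmod h
    exact h1 (mem_core_of_le he hcore hK (hmod.trans (sub_self_modEq _).symm) (by omega))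
  · intro h
    by_contra hlt
    exact h (mem_core_of_le he hcore h2
      ((sub_self_modEq _).trans (hmod.symm.trans (sub_self_modEq _).symm)) (by omega))

lemma epsVec_of_mem_core (he : 0 < e) (hook : IsHookQuotient e lam) (hcore : IsCoreOf e kap lam)
    (hw : eWeight e lam = w) {i j : Fin w} (hi : start hw i ∈ beta kap)
    (hj : start hw j = start hw i + e) :
    epsVec hw i = Pi.single i 1 - Pi.single j 1 := by
  have hmono := start_strictMono he hook hw
  have he' : (0 : ℤ) < e := by exact_mod_cast he
  rw [epsVec, dif_pos ((lt_pivot_iff he hook hcore hw i).2 hi)]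
  congr 2
  apply le_antisymm
  · refine Finset.min'_le _ j (Finset.mem_filter.2 ⟨?_, ?_⟩)
    · rw [mem_runnerIdx, hj]
      exact add_self_modEq _
    · rw [← hmono.lt_iff_lt]
      omega
  · refine Finset.le_min' _ _ _ fun k hk => ?_
    obtain ⟨h1, h2⟩ := Finset.mem_filter.1 hk
    rw [← hmono.le_iff_le, hj]
    exact add_le_of_modEq_of_lt ((mem_runnerIdx hw).1 h1).symm (hmono h2)

lemma epsVec_of_sub_notMem_core (he : 0 < e) (hook : IsHookQuotient e lam)
    (hcore : IsCoreOf e kap lam) (hw : eWeight e lam = w) {i j : Fin w}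
    (hi : start hw i - e ∉ beta kap) (hj : start hw j = start hw i - e) :
    epsVec hw i = Pi.single i 1 - Pi.single j 1 := by
  have hmono := start_strictMono he hook hw
  have he' : (0 : ℤ) < e := by exact_mod_cast he
  have hp := (pivot_lt_iff he hook hcore hw i).2 hi
  rw [epsVec, dif_neg hp.not_gt, dif_pos hp]
  congr 2
  apply le_antisymm
  · refine Finset.max'_le _ _ _ fun k hk => ?_
    obtain ⟨h1, h2⟩ := Finset.mem_filter.1 hk
    have := add_le_of_modEq_of_lt ((mem_runnerIdx hw).1 h1) (hmono h2)
    rw [← hmono.le_iff_le, hj]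
    omega
  · refine Finset.le_max' _ j (Finset.mem_filter.2 ⟨?_, ?_⟩)
    · rw [mem_runnerIdx, hj]
      exact sub_self_modEq _
    · rw [← hmono.lt_iff_lt]
      omega

lemma epsVec_of_notMem_core (he : 0 < e) (hook : IsHookQuotient e lam) (hcore : IsCoreOf e kap lam)
    (hw : eWeight e lam = w) {i : Fin w} (hi : start hw i ∉ beta kap)
    (hi' : start hw i - e ∈ beta kap) : epsVec hw i = Pi.single i 1 := by
  rw [epsVec, dif_neg (mt (lt_pivot_iff he hook hcore hw i).1 hi),
    dif_neg fun h => (pivot_lt_iff he hook hcore hw i).1 h hi']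

end Labels

/-! ### Monotonicity of subdifferentials and faces of parallelotopes -/

section Selections

/-! For affine forms `v` with linear parts `a`, the sums of `a T` over selections at a point `p` are
the vertices of the subdifferential at `p` of the convex function `∑ T, max (v T) 0`. -/

variable {ι : Type*} {w : ℕ}

/-- A set of indices that contains all positive and no negative values of `v`. -/
def IsSelection (v : ι → ℤ) (S : Finset ι) : Prop :=
  ∀ T, (0 < v T → T ∈ S) ∧ (v T < 0 → T ∉ S)

/-- Two selections, at points where the forms take values `v` and `v'`, with the same sum can differ
only in forms that vanish at both points. -/
lemma IsSelection.mem_iff_or [Fintype ι] {a : ι → Fin w → ℤ} {v v' : ι → ℤ} {p p' : Fin w → ℤ}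
    (hv : ∀ T, v T - v' T = ∑ i, a T i * (p i - p' i)) {S S' : Finset ι}
    (hS : IsSelection v S) (hS' : IsSelection v' S') (h : ∑ T ∈ S, a T = ∑ T ∈ S', a T) (T : ι) :
    (T ∈ S ↔ T ∈ S') ∨ (v T = 0 ∧ v' T = 0) := by
  classical
  have hsum : ∀ R : Finset ι, ∑ T, (if T ∈ R then v T - v' T else 0) =
      ∑ i, (∑ T ∈ R, a T) i * (p i - p' i) := by
    intro R
    rw [← Finset.sum_filter, Finset.filter_mem_eq_inter, Finset.univ_inter]
    simp only [hv, Finset.sum_apply, Finset.sum_mul]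
    exact Finset.sum_comm
  have hzero : ∑ T, ((if T ∈ S then v T - v' T else 0) - (if T ∈ S' then v T - v' T else 0)) = 0 := by
    rw [Finset.sum_sub_distrib, hsum, hsum, h, sub_self]
  -- A form in `S` but not in `S'` satisfies `v T ≥ 0 ≥ v' T`, and conversely, so every term is
  -- nonnegative. The total is the pairing of the difference of the two sums with `p - p'`, which is
  -- zero, so every term vanishes.
  have hnonneg : ∀ T ∈ Finset.univ, 0 ≤
      (if T ∈ S then v T - v' T else 0) - (if T ∈ S' then v T - v' T else 0) := by
    intro T _
    have h1 := hS T
    have h2 := hS' T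
    split_ifs with h3 h4 h4
    · omega
    · have : ¬ v T < 0 := fun h => h1.2 h h3
      have : ¬ 0 < v' T := fun h => h4 (h2.1 h)
      omega
    · have : ¬ 0 < v T := fun h => h3 (h1.1 h)
      have : ¬ v' T < 0 := fun h => h2.2 h h4
      omega
    · omega
  have hT := (Finset.sum_eq_zero_iff_of_nonneg hnonneg).1 hzero T (Finset.mem_univ T)
  have h1 := hS T
  have h2 := hS' T
  by_cases h3 : T ∈ S <;> by_cases h4 : T ∈ S' <;> simp only [h3, h4, if_true, if_false] at hT
  · exact Or.inl (by tauto)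
  · have : ¬ v T < 0 := fun h => h1.2 h h3
    have : ¬ 0 < v' T := fun h => h4 (h2.1 h)
    exact Or.inr ⟨by omega, by omega⟩
  · have : ¬ 0 < v T := fun h => h3 (h1.1 h)
    have : ¬ v' T < 0 := fun h => h2.2 h h4
    exact Or.inr ⟨by omega, by omega⟩
  · exact Or.inl (by tauto)

/-- The parallelotope with base point `z` and edges `ε` consists of the sums over selections for `v`:
the base point is the sum over `S₀`, and the `i`-th edge toggles the vanishing form `τ i`. -/
structure IsFrame (v : ι → ℤ) (a : ι → Fin w → ℤ) (S₀ : Finset ι) (τ : Fin w → ι)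
    (z : Fin w → ℤ) (ε : Fin w → Fin w → ℤ) : Prop where
  isSelection : IsSelection v S₀
  base : z = ∑ T ∈ S₀, a T
  apply_eq_zero : ∀ i, v (τ i) = 0
  edge_of_mem : ∀ i, τ i ∈ S₀ → ε i = -a (τ i)
  edge_of_notMem : ∀ i, τ i ∉ S₀ → ε i = a (τ i)
  exists_eq : ∀ T, v T = 0 → ∃ i, τ i = T
  indep : LinearIndependent ℤ ε

namespace IsFrame

variable {v : ι → ℤ} {a : ι → Fin w → ℤ} {S₀ : Finset ι} {τ : Fin w → ι} {z : Fin w → ℤ}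
  {ε : Fin w → Fin w → ℤ}

/-- The edge `ε i` is determined by `τ i`, sign included, and independent vectors are distinct. -/
lemma injective (hf : IsFrame v a S₀ τ z ε) : Function.Injective τ := by
  intro i j hij
  apply hf.indep.injective
  by_cases h : τ i ∈ S₀
  · rw [hf.edge_of_mem i h, hf.edge_of_mem j (hij ▸ h), hij]
  · rw [hf.edge_of_notMem i h, hf.edge_of_notMem j (hij ▸ h), hij]

/-- `S` is obtained from `S₀` by toggling the forms indexed by `G`. -/
def Toggles (S₀ : Finset ι) (τ : Fin w → ι) (S : Finset ι) (G : Finset (Fin w)) : Prop :=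
  ∀ i, i ∈ G ↔ ¬ (τ i ∈ S ↔ τ i ∈ S₀)

lemma mem_iff_of_ne_zero (hf : IsFrame v a S₀ τ z ε) {S : Finset ι} (hS : IsSelection v S) {T : ι}
    (hT : v T ≠ 0) : T ∈ S ↔ T ∈ S₀ := by
  have h1 := hS T
  have h2 := hf.isSelection T
  rcases hT.lt_or_gt with h | h
  · exact iff_of_false (h1.2 h) (h2.2 h)
  · exact iff_of_true (h1.1 h) (h2.1 h)

/-- `S` and `S₀` can differ only in vanishing forms, that is, in `τ i` for `i ∈ G`. Inserting `τ i`
adds `a (τ i)` and deleting it subtracts this; in both cases the change is `ε i`. -/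
lemma sum_eq (hf : IsFrame v a S₀ τ z ε) {S : Finset ι} {G : Finset (Fin w)}
    (hS : IsSelection v S) (hG : Toggles S₀ τ S G) :
    ∑ T ∈ S, a T = z + ∑ i ∈ G, ε i := by
  classical
  have hdiff : ∑ T ∈ S \ S₀, a T = ∑ i ∈ G.filter (fun i => τ i ∉ S₀), ε i := by
    refine (Finset.sum_nbij τ ?_ hf.injective.injOn ?_ ?_).symm
    · intro i hi
      have := hG i
      simp only [Finset.mem_filter, Finset.mem_sdiff] at hi ⊢
      tauto
    · intro T hT
      simp only [Finset.coe_sdiff, Set.mem_sdiff, Finset.mem_coe] at hT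
      have hz : v T = 0 := by
        by_contra h
        exact hT.2 ((hf.mem_iff_of_ne_zero hS h).1 hT.1)
      obtain ⟨i, rfl⟩ := hf.exists_eq T hz
      have := hG i
      exact ⟨i, by simp only [Finset.coe_filter, Set.mem_ofPred_eq]; tauto, rfl⟩
    · intro i hi
      exact hf.edge_of_notMem i (Finset.mem_filter.1 hi).2
  have hdiff' : ∑ T ∈ S₀ \ S, a T = -∑ i ∈ G.filter (fun i => ¬ τ i ∉ S₀), ε i := by
    rw [← Finset.sum_neg_distrib]
    refine (Finset.sum_nbij τ ?_ hf.injective.injOn ?_ ?_).symm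
    · intro i hi
      have := hG i
      simp only [Finset.mem_filter, Finset.mem_sdiff] at hi ⊢
      tauto
    · intro T hT
      simp only [Finset.coe_sdiff, Set.mem_sdiff, Finset.mem_coe] at hT
      have hz : v T = 0 := by
        by_contra h
        exact hT.2 ((hf.mem_iff_of_ne_zero hS h).2 hT.1)
      obtain ⟨i, rfl⟩ := hf.exists_eq T hz
      have := hG i
      exact ⟨i, by simp only [Finset.coe_filter, Set.mem_ofPred_eq]; tauto, rfl⟩
    · intro i hi
      rw [hf.edge_of_mem i (not_not.1 (Finset.mem_filter.1 hi).2), neg_neg]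
  rw [← Finset.sum_filter_add_sum_filter_not G (fun i => τ i ∉ S₀), ← hdiff, ← neg_eq_iff_eq_neg.2 hdiff',
    hf.base, ← sub_eq_add_neg, Finset.sum_sdiff_sub_sum_sdiff]
  abel

lemma exists_toggles (S : Finset ι) : ∃ G : Finset (Fin w), Toggles S₀ τ S G := by
  classical
  exact ⟨Finset.univ.filter fun i => ¬ (τ i ∈ S ↔ τ i ∈ S₀), fun i => by simp⟩

lemma exists_isSelection (hf : IsFrame v a S₀ τ z ε) (G : Finset (Fin w)) :
    ∃ S, IsSelection v S ∧ Toggles S₀ τ S G := by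
  classical
  have hmem : ∀ T, T ∈ symmDiff S₀ (G.image τ) ↔ ¬ (T ∈ S₀ ↔ ∃ i ∈ G, τ i = T) := by
    intro T
    simp only [Finset.mem_symmDiff, Finset.mem_image]
    by_cases h : ∃ i ∈ G, τ i = T <;> simp only [h] <;> tauto
  refine ⟨symmDiff S₀ (G.image τ), fun T => ?_, fun i => ?_⟩
  · have hT : v T ≠ 0 → ¬ ∃ i ∈ G, τ i = T := by
      rintro h ⟨i, -, rfl⟩
      exact h (hf.apply_eq_zero i)
    have h := hf.isSelection T
    rw [hmem]
    constructor <;> intro h'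
    · have := hT h'.ne'
      simp [h.1 h', this]
    · have := hT h'.ne
      simp [h.2 h', this]
  · have : (∃ j ∈ G, τ j = τ i) ↔ i ∈ G :=
      ⟨fun ⟨j, hj, h⟩ => hf.injective h ▸ hj, fun h => ⟨i, h, rfl⟩⟩
    rw [hmem, this]
    tauto

/-- As the edges are independent, the sum determines the set of toggled forms, and the other forms
are fixed by their signs. -/
lemma eq_of_sum_eq (hf : IsFrame v a S₀ τ z ε) {S S' : Finset ι} (hS : IsSelection v S)
    (hS' : IsSelection v S') (h : ∑ T ∈ S, a T = ∑ T ∈ S', a T) : S = S' := by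
  classical
  obtain ⟨G, hG⟩ := exists_toggles (S₀ := S₀) (τ := τ) S
  obtain ⟨G', hG'⟩ := exists_toggles (S₀ := S₀) (τ := τ) S'
  rw [hf.sum_eq hS hG, hf.sum_eq hS' hG', add_right_inj] at h
  have hzero : ∑ i, ((if i ∈ G then (1 : ℤ) else 0) - (if i ∈ G' then 1 else 0)) • ε i = 0 := by
    simp only [sub_smul, ite_smul, one_smul, zero_smul, Finset.sum_sub_distrib,
      Finset.sum_ite_mem, Finset.univ_inter, h, sub_self]
  have hGG := Fintype.linearIndependent_iff.1 hf.indep _ hzero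
  ext T
  by_cases hT : v T = 0
  · obtain ⟨i, rfl⟩ := hf.exists_eq T hT
    have h1 := hG i
    have h2 := hG' i
    have h3 : i ∈ G ↔ i ∈ G' := by
      have := hGG i
      by_cases h4 : i ∈ G <;> by_cases h5 : i ∈ G' <;> simp_all
    tauto
  · rw [hf.mem_iff_of_ne_zero hS hT, hf.mem_iff_of_ne_zero hS' hT]

lemma exists_vertex_iff (hf : IsFrame v a S₀ τ z ε) {x : Fin w → ℤ} :
    (∃ G : Finset (Fin w), x = z + ∑ i ∈ G, ε i) ↔ ∃ S, IsSelection v S ∧ x = ∑ T ∈ S, a T := by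
  constructor
  · rintro ⟨G, rfl⟩
    obtain ⟨S, hS, hG⟩ := hf.exists_isSelection G
    exact ⟨S, hS, (hf.sum_eq hS hG).symm⟩
  · rintro ⟨S, hS, rfl⟩
    obtain ⟨G, hG⟩ := exists_toggles (S₀ := S₀) (τ := τ) S
    exact ⟨G, hf.sum_eq hS hG⟩

/-- The sums over selections that are also selections for `v'` form a face. -/
lemma isFace_common (hf : IsFrame v a S₀ τ z ε) (v' : ι → ℤ) :
    {x | ∃ S, (IsSelection v S ∧ IsSelection v' S) ∧ x = ∑ T ∈ S, a T} = ∅ ∨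
    ∃ G0 G1 : Finset (Fin w), Disjoint G0 G1 ∧
      {x | ∃ S, (IsSelection v S ∧ IsSelection v' S) ∧ x = ∑ T ∈ S, a T} =
        {x | ∃ G : Finset (Fin w), G1 ⊆ G ∧ G ⊆ G0ᶜ ∧ x = z + ∑ i ∈ G, ε i} := by
  classical
  by_cases hex : ∃ R, IsSelection v R ∧ IsSelection v' R
  · right
    obtain ⟨R, hR, hR'⟩ := hex
    -- The sign of `v' (τ i)`, if nonzero, forces the membership of `τ i`. If this agrees with `S₀`,
    -- toggling `i` is forbidden (`G0`); if not, it is required (`G1`).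
    refine ⟨Finset.univ.filter fun i => (0 < v' (τ i) ∧ τ i ∈ S₀) ∨ (v' (τ i) < 0 ∧ τ i ∉ S₀),
      Finset.univ.filter fun i => (0 < v' (τ i) ∧ τ i ∉ S₀) ∨ (v' (τ i) < 0 ∧ τ i ∈ S₀), ?_, ?_⟩
    · rw [Finset.disjoint_left]
      intro i h1 h2
      simp only [Finset.mem_filter, Finset.mem_univ, true_and] at h1 h2
      rcases h1 with h1 | h1 <;> rcases h2 with h2 | h2
      · exact h2.2 h1.2
      · omega
      · omega
      · exact h1.2 h2.2
    · ext x
      simp only [Set.mem_ofPred_eq, Finset.subset_iff, Finset.mem_filter, Finset.mem_univ, true_and,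
        Finset.mem_compl]
      constructor
      · rintro ⟨S, ⟨hS, hS'⟩, rfl⟩
        obtain ⟨G, hG⟩ := exists_toggles (S₀ := S₀) (τ := τ) S
        refine ⟨G, fun i hi => ?_, fun i hi h => ?_, hf.sum_eq hS hG⟩
        · have h1 := hS' (τ i)
          rw [hG i]
          tauto
        · have h1 := hS' (τ i)
          rw [hG i] at hi
          tauto
      · rintro ⟨G, h1, h0, rfl⟩
        obtain ⟨S, hS, hG⟩ := hf.exists_isSelection G
        refine ⟨S, ⟨hS, fun T => ?_⟩, (hf.sum_eq hS hG).symm⟩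
        by_cases hT : v T = 0
        · obtain ⟨i, rfl⟩ := hf.exists_eq T hT
          have h2 := hG i
          have h3 := @h1 i
          have h4 := @h0 i
          constructor <;> intro h5 <;> have h6 := h5.not_gt <;> tauto
        -- All selections for `v` agree on the forms where `v` is nonzero, so the common selection
        -- `R` shows that the signs of `v'` are respected there.
        · rw [hf.mem_iff_of_ne_zero hS hT, ← hf.mem_iff_of_ne_zero hR hT]
          exact hR' T
  · left
    ext x
    simp only [Set.mem_ofPred_eq, Set.mem_empty_iff_false, iff_false]
    rintro ⟨S, hS, -⟩
    exact hex ⟨S, hS⟩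

/-- The common points of two parallelotopes are the sums over common selections. -/
lemma inter_eq [Fintype ι] (hf : IsFrame v a S₀ τ z ε) {v' : ι → ℤ} {S₀' : Finset ι}
    {τ' : Fin w → ι} {z' : Fin w → ℤ} {ε' : Fin w → Fin w → ℤ} (hf' : IsFrame v' a S₀' τ' z' ε')
    {p p' : Fin w → ℤ} (hv : ∀ T, v T - v' T = ∑ i, a T i * (p i - p' i)) :
    {x | ∃ G : Finset (Fin w), x = z + ∑ i ∈ G, ε i} ∩
      {x | ∃ G : Finset (Fin w), x = z' + ∑ i ∈ G, ε' i} =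
    {x | ∃ S, (IsSelection v S ∧ IsSelection v' S) ∧ x = ∑ T ∈ S, a T} := by
  ext x
  simp only [Set.mem_inter_iff, Set.mem_ofPred_eq, hf.exists_vertex_iff, hf'.exists_vertex_iff]
  constructor
  · rintro ⟨⟨S, hS, rfl⟩, S', hS', h⟩
    have hcmp := hS.mem_iff_or hv hS' h
    -- `S'` differs from `S` only where `v` vanishes, so it is a selection for `v` too, and
    -- uniqueness applies to `S` and `S'`.
    have hS'v : IsSelection v S' := by
      intro T
      have := hS T
      rcases hcmp T with h1 | h1
      · rwa [← h1]
      · constructor <;> intro h2 <;> omega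
    have := hf.eq_of_sum_eq hS hS'v h
    exact ⟨S, ⟨hS, this ▸ hS'⟩, rfl⟩
  · rintro ⟨S, ⟨hS, hS'⟩, rfl⟩
    exact ⟨⟨S, hS, rfl⟩, S, hS', rfl⟩

end IsFrame

end Selections

/-! ### The label as a subgradient, and the frame of a hook-quotient partition -/

section Frames

variable {e w : ℕ} {lam kap : YoungDiagram}

lemma finite_coreVacancies (e : ℕ) (kap : YoungDiagram) :
    {d : ℤ | d ∉ beta kap ∧ d - e ∈ beta kap}.Finite := by
  refine (Set.finite_Icc (-(kap.colLen 0 : ℤ)) ((kap.rowLen 0 : ℤ) - 1 + e)).subset ?_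
  rintro d ⟨h1, h2⟩
  have := le_of_mem_beta kap h2
  refine ⟨?_, by omega⟩
  by_contra h
  exact h1 (mem_beta_of_lt kap (not_le.1 h))

/-- The first vacancies on the runners of a core. -/
noncomputable def coreVacancies (e : ℕ) (kap : YoungDiagram) : Finset ℤ :=
  (finite_coreVacancies e kap).toFinset

lemma mem_coreVacancies {d : ℤ} :
    d ∈ coreVacancies e kap ↔ d ∉ beta kap ∧ d - e ∈ beta kap := by
  simp [coreVacancies]

open Classical in
-- A window of length `e` ending at `q` meets each runner once, and since the core has no gaps, it
-- meets it in a vacancy iff the first vacancy `d` of the runner is at most `q`. The induction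
-- slides the window from far left, where both sides are zero; each step changes both by one exactly
-- when `q` is a first vacancy.
lemma sum_core_vacant_indicator (he : 0 < e) (hcore : IsCoreOf e kap lam) (q : ℤ) :
    ∑ x ∈ Finset.Ioc (q - e) q, (if x ∉ beta kap then (1 : ℤ) else 0) =
      ∑ d ∈ coreVacancies e kap, if d ≤ q then 1 else 0 := by
  have hsmall : ∀ q : ℤ, q < -(kap.colLen 0 : ℤ) →
      ∑ x ∈ Finset.Ioc (q - e) q, (if x ∉ beta kap then (1 : ℤ) else 0) =
      ∑ d ∈ coreVacancies e kap, if d ≤ q then 1 else 0 := by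
    intro q hq
    rw [Finset.sum_eq_zero, Finset.sum_eq_zero]
    · intro d hd
      refine if_neg fun h => (mem_coreVacancies.1 hd).1 (mem_beta_of_lt kap (by omega))
    · intro x hx
      rw [Finset.mem_Ioc] at hx
      exact if_neg (not_not.2 (mem_beta_of_lt kap (by omega)))
  obtain ⟨n, hn⟩ : ∃ n : ℕ, q < -(kap.colLen 0 : ℤ) + n :=
    ⟨(q + kap.colLen 0 + 1).toNat, by have := Int.self_le_toNat (q + kap.colLen 0 + 1); omega⟩
  induction n generalizing q with
  | zero => exact hsmall q (by simpa using hn)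
  | succ n ih =>
    have hprev := ih (q - 1) (by push_cast at hn; omega)
    have h1 : ∑ x ∈ Finset.Ioc (q - 1 - e) q, (if x ∉ beta kap then (1 : ℤ) else 0) =
        ∑ x ∈ Finset.Ioc (q - e) q, (if x ∉ beta kap then (1 : ℤ) else 0) +
          (if q - e ∉ beta kap then 1 else 0) := by
      have : Finset.Ioc (q - 1 - e) q = insert (q - e) (Finset.Ioc (q - e) q) := by
        ext x
        simp only [Finset.mem_Ioc, Finset.mem_insert]
        omega
      rw [this, Finset.sum_insert (by simp), add_comm]
    have h2 : ∑ x ∈ Finset.Ioc (q - 1 - e) q, (if x ∉ beta kap then (1 : ℤ) else 0) =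
        ∑ x ∈ Finset.Ioc (q - 1 - e) (q - 1), (if x ∉ beta kap then (1 : ℤ) else 0) +
          (if q ∉ beta kap then 1 else 0) := by
      have : Finset.Ioc (q - 1 - e) q = insert q (Finset.Ioc (q - 1 - e) (q - 1)) := by
        ext x
        simp only [Finset.mem_Ioc, Finset.mem_insert]
        omega
      rw [this, Finset.sum_insert (by simp), add_comm]
    have h3 : (∑ d ∈ coreVacancies e kap, if d ≤ q then (1 : ℤ) else 0) =
        (∑ d ∈ coreVacancies e kap, if d ≤ q - 1 then (1 : ℤ) else 0) +
          if q ∈ coreVacancies e kap then 1 else 0 := by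
      rw [← Finset.sum_ite_eq' (coreVacancies e kap) q fun _ => (1 : ℤ), ← Finset.sum_add_distrib]
      refine Finset.sum_congr rfl fun d _ => ?_
      split_ifs <;> omega
    have h4 := @sub_mem_core _ _ _ he hcore q
    simp only [mem_coreVacancies] at h3
    by_cases hq : q ∈ beta kap
    · have := h4 hq
      simp only [hq, this, not_true_eq_false, if_false, false_and] at h1 h2 h3
      omega
    · by_cases hq' : q - e ∈ beta kap
      · simp only [hq, hq', not_true_eq_false, not_false_eq_true, if_true, if_false, and_self]
          at h1 h2 h3
        omega
      · simp only [hq, hq', not_false_eq_true, if_true, if_false, and_false] at h1 h2 h3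
        omega

open Classical in
lemma sum_range_indicator {q : Fin w → ℤ} (hq : Function.Injective q) (s : Finset ℤ) :
    ∑ x ∈ s, (if x ∈ Set.range q then (1 : ℤ) else 0) = ∑ j, if q j ∈ s then 1 else 0 := by
  have h : ∀ x, (if x ∈ Set.range q then (1 : ℤ) else 0) = ∑ j, if q j = x then 1 else 0 := by
    intro x
    split_ifs with hx
    · obtain ⟨i, rfl⟩ := hx
      simp [hq.eq_iff]
    · refine (Finset.sum_eq_zero fun j _ => if_neg fun h => hx ⟨j, h⟩).symm
  simp only [h]
  rw [Finset.sum_comm]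
  refine Finset.sum_congr rfl fun j _ => ?_
  rw [Finset.sum_ite_eq]

/-- This is `vacant_indicator` summed over the window of the label, with the middle term shifted by
`e`. The right side involves `lam` only through its starting positions. -/
lemma zLabel_eq (he : 0 < e) (hook : IsHookQuotient e lam) (hcore : IsCoreOf e kap lam)
    (hw : eWeight e lam = w) (i : Fin w) :
    zLabel hw i = (∑ d ∈ coreVacancies e kap, if d ≤ start hw i then 1 else 0) +
      (∑ j, if start hw i < start hw j ∧ start hw j ≤ start hw i + e then 1 else 0) -
      ∑ j, if start hw i - e < start hw j ∧ start hw j ≤ start hw i then 1 else 0 := by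
  classical
  have hinj := (start_strictMono he hook hw).injective
  have h1 : zLabel hw i = ∑ x ∈ Finset.Ioc (start hw i - e) (start hw i),
      (if x ∉ beta lam then (1 : ℤ) else 0) := by
    rw [zLabel, armCount, ← Finset.sum_filter, Finset.sum_const, nsmul_eq_mul, mul_one,
      ← Set.ncard_coe_finset]
    congr 2
    ext x
    simp
  have h2 : ∑ x ∈ Finset.Ioc (start hw i - e) (start hw i),
        (if x + e ∈ Set.range (start hw) then (1 : ℤ) else 0) =
      ∑ x ∈ Finset.Ioc (start hw i) (start hw i + e),
        (if x ∈ Set.range (start hw) then (1 : ℤ) else 0) := by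
    refine Finset.sum_nbij' (· + (e : ℤ)) (· - (e : ℤ)) ?_ ?_ ?_ ?_ ?_
    · intro x hx
      simp only [Finset.mem_Ioc] at hx ⊢
      omega
    · intro x hx
      simp only [Finset.mem_Ioc] at hx ⊢
      omega
    · intro x _
      simp
    · intro x _
      simp
    · intro x _
      rfl
  simp only [vacant_indicator he hook hcore hw] at h1
  rw [h1, Finset.sum_sub_distrib, Finset.sum_add_distrib, sum_core_vacant_indicator he hcore, h2,
    sum_range_indicator hinj, sum_range_indicator hinj]
  simp only [Finset.mem_Ioc]

/-- Apart from `epsVec hw i`, only vectors of neighbours of `i` pointing towards it, from the side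
away from the pivot, have nonzero `i`-th coordinate. In a linear relation the coefficients thus
vanish from both ends of a runner inwards, and at the pivot last. -/
lemma linearIndependent_epsVec (he : 0 < e) (hook : IsHookQuotient e lam)
    (hcore : IsCoreOf e kap lam) (hw : eWeight e lam = w) :
    LinearIndependent ℤ (epsVec hw) := by
  have hmono := start_strictMono he hook hw
  have he' : (0 : ℤ) < e := by exact_mod_cast he
  have hself : ∀ i, epsVec hw i i = 1 := by
    intro i
    by_cases h1 : start hw i ∈ beta kap
    · obtain ⟨j, hj⟩ := start_add_mem_range he hook hcore hw h1
      have : i ≠ j := by rintro rfl; omega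
      rw [epsVec_of_mem_core he hook hcore hw h1 hj]
      simp [this]
    · by_cases h2 : start hw i - e ∈ beta kap
      · rw [epsVec_of_notMem_core he hook hcore hw h1 h2]
        simp
      · obtain ⟨j, hj⟩ := start_sub_mem_range he hook hcore hw h2
        have : i ≠ j := by rintro rfl; omega
        rw [epsVec_of_sub_notMem_core he hook hcore hw h2 hj]
        simp [this]
  have hother : ∀ i j, i ≠ j → epsVec hw j i ≠ 0 →
      (start hw j ∈ beta kap ∧ start hw i = start hw j + e) ∨
      (start hw j - e ∉ beta kap ∧ start hw i = start hw j - e) := by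
    intro i j hij h
    by_cases h1 : start hw j ∈ beta kap
    · obtain ⟨k, hk⟩ := start_add_mem_range he hook hcore hw h1
      rw [epsVec_of_mem_core he hook hcore hw h1 hk] at h
      have : i = k := by
        by_contra hik
        simp [hij, hik] at h
      exact Or.inl ⟨h1, this ▸ hk⟩
    · by_cases h2 : start hw j - e ∈ beta kap
      · rw [epsVec_of_notMem_core he hook hcore hw h1 h2] at h
        simp [hij] at h
      · obtain ⟨k, hk⟩ := start_sub_mem_range he hook hcore hw h2
        rw [epsVec_of_sub_notMem_core he hook hcore hw h2 hk] at h
        have : i = k := by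
          by_contra hik
          simp [hij, hik] at h
        exact Or.inr ⟨h2, this ▸ hk⟩
  rw [Fintype.linearIndependent_iff]
  intro g hg
  have hstep : ∀ i, (∀ j, i ≠ j → epsVec hw j i ≠ 0 → g j = 0) → g i = 0 := by
    intro i h
    have h1 := congrFun hg i
    rw [Finset.sum_apply, Finset.sum_eq_single i] at h1
    · simpa [hself] using h1
    · intro j _ hj
      by_cases h2 : epsVec hw j i = 0
      · simp [h2]
      · simp [h j hj.symm h2]
    · simp
  have hlow : ∀ i, start hw i ∈ beta kap → g i = 0 := by
    intro i
    induction i using WellFoundedLT.induction with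
    | ind i ih =>
      intro hi
      refine hstep i fun j hij hj => ?_
      rcases hother i j hij hj with ⟨h1, h2⟩ | ⟨h1, h2⟩
      · exact ih j (hmono.lt_iff_lt.1 (by omega)) h1
      · exact absurd (h2 ▸ hi) h1
  have hhigh : ∀ i, start hw i - e ∉ beta kap → g i = 0 := by
    intro i
    induction i using WellFoundedGT.induction with
    | ind i ih =>
      intro hi
      refine hstep i fun j hij hj => ?_
      rcases hother i j hij hj with ⟨h1, h2⟩ | ⟨h1, h2⟩
      · exact hlow j h1
      · exact ih j (hmono.lt_iff_lt.1 (by omega)) h1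
  intro i
  refine hstep i fun j hij hj => ?_
  rcases hother i j hij hj with ⟨h1, h2⟩ | ⟨h1, h2⟩
  · exact hlow j h1
  · exact hhigh j h1

/-- Indices of the affine forms `q_i - d`, for a first vacancy `d` of the core, and `q_i - q_j + e`. -/
abbrev FormIdx (e w : ℕ) (kap : YoungDiagram) : Type :=
  (Fin w × coreVacancies e kap) ⊕ (Fin w × Fin w)

/-- The linear parts of the forms; those with `j ≤ i` are replaced by zero. -/
def formLin (e w : ℕ) (kap : YoungDiagram) : FormIdx e w kap → Fin w → ℤ
  | .inl (i, _) => Pi.single i 1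
  | .inr (i, j) => if i < j then Pi.single i 1 - Pi.single j 1 else 0

/-- The values of the forms at `q`; those with `j ≤ i` are replaced by a negative constant. -/
def formVal (e : ℕ) (kap : YoungDiagram) (q : Fin w → ℤ) : FormIdx e w kap → ℤ
  | .inl (i, d) => q i - d
  | .inr (i, j) => if i < j then q i - q j + e else -1

lemma formVal_sub (q q' : Fin w → ℤ) (T : FormIdx e w kap) :
    formVal e kap q T - formVal e kap q' T = ∑ i, formLin e w kap T i * (q i - q' i) := by
  rcases T with ⟨i, d⟩ | ⟨i, j⟩
  · simp [formVal, formLin, Pi.single_apply]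
  · by_cases h : i < j
    · simp only [formVal, formLin, h, if_true, Pi.sub_apply, sub_mul, Finset.sum_sub_distrib]
      simp [Pi.single_apply]
      ring
    · simp [formVal, formLin, h]

open Classical in
/-- The selection whose sum is the label of a hook-quotient partition. -/
noncomputable def baseSel (e : ℕ) (kap : YoungDiagram) (q : Fin w → ℤ) :
    Finset (FormIdx e w kap) :=
  Finset.univ.filter fun T => match T with
    | .inl (i, d) => (d : ℤ) < q i
    | .inr (i, j) => i < j ∧ (q j < q i + e ∨ (q j = q i + e ∧ q i ∉ beta kap))

lemma inl_mem_baseSel {q : Fin w → ℤ} {i : Fin w} {d : coreVacancies e kap} :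
    Sum.inl (i, d) ∈ baseSel e kap q ↔ (d : ℤ) < q i := by
  simp [baseSel]

lemma inr_mem_baseSel {q : Fin w → ℤ} {i j : Fin w} :
    Sum.inr (i, j) ∈ baseSel e kap q ↔
      i < j ∧ (q j < q i + e ∨ (q j = q i + e ∧ q i ∉ beta kap)) := by
  simp [baseSel]

open Classical in
lemma sum_baseSel (q : Fin w → ℤ) (i : Fin w) :
    (∑ T ∈ baseSel e kap q, formLin e w kap T) i =
      (∑ d ∈ coreVacancies e kap, if d < q i then 1 else 0) +
      (∑ j, if i < j ∧ (q j < q i + e ∨ (q j = q i + e ∧ q i ∉ beta kap)) then 1 else 0) -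
      ∑ j, if j < i ∧ (q i < q j + e ∨ (q i = q j + e ∧ q j ∉ beta kap)) then 1 else 0 := by
  have h0 : ∑ T ∈ baseSel e kap q, formLin e w kap T =
      ∑ T, if T ∈ baseSel e kap q then formLin e w kap T else 0 := by
    rw [Finset.sum_ite_mem, Finset.univ_inter]
  rw [h0, Finset.sum_apply, Fintype.sum_sum_type, Fintype.sum_prod_type, Fintype.sum_prod_type,
    add_sub_assoc]
  simp only [inl_mem_baseSel, inr_mem_baseSel]
  congr 1
  · rw [Finset.sum_eq_single i]
    · rw [← Finset.sum_coe_sort (coreVacancies e kap)]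
      refine Finset.sum_congr rfl fun d _ => ?_
      split_ifs <;> simp [formLin]
    · intro j _ hj
      refine Finset.sum_eq_zero fun d _ => ?_
      split_ifs <;> simp [formLin, hj.symm]
    · simp
  · have h : ∀ k j : Fin w,
        (if k < j ∧ (q j < q k + e ∨ (q j = q k + e ∧ q k ∉ beta kap)) then
          formLin e w kap (Sum.inr (k, j)) else 0) i =
        (if i = k then (if k < j ∧ (q j < q k + e ∨ (q j = q k + e ∧ q k ∉ beta kap))
          then 1 else 0) else 0) -
        (if i = j then (if k < j ∧ (q j < q k + e ∨ (q j = q k + e ∧ q k ∉ beta kap))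
          then 1 else 0) else 0) := by
      intro k j
      by_cases hc : k < j ∧ (q j < q k + e ∨ (q j = q k + e ∧ q k ∉ beta kap))
      · rw [if_pos hc, if_pos hc]
        simp [formLin, hc.1, Pi.single_apply]
      · rw [if_neg hc, if_neg hc]
        simp
    simp only [h, Finset.sum_sub_distrib]
    congr 1
    · rw [Finset.sum_comm]
      simp
    · simp

/-- The two formulas differ only in ties and in the term `j = i`. The corrections are `+1` if `q i`
is a first vacancy, `+1` if `q i` is in the core, `+1` if `q i - e` is not in the core, and `-1` for
`j = i`. Exactly one of the three conditions holds, so they cancel. -/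
lemma zLabel_eq_sum_baseSel (he : 0 < e) (hook : IsHookQuotient e lam)
    (hcore : IsCoreOf e kap lam) (hw : eWeight e lam = w) :
    zLabel hw = ∑ T ∈ baseSel e kap (start hw), formLin e w kap T := by
  classical
  have hmono := start_strictMono he hook hw
  have he' : (0 : ℤ) < e := by exact_mod_cast he
  ext i
  rw [zLabel_eq he hook hcore, sum_baseSel]
  set q := start hw with hq
  have hd : (∑ d ∈ coreVacancies e kap, if d ≤ q i then (1 : ℤ) else 0) =
      (∑ d ∈ coreVacancies e kap, if d < q i then 1 else 0) +
        if q i ∉ beta kap ∧ q i - e ∈ beta kap then 1 else 0 := by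
    simp only [← mem_coreVacancies]
    rw [← Finset.sum_ite_eq' (coreVacancies e kap) (q i) fun _ => (1 : ℤ), ← Finset.sum_add_distrib]
    refine Finset.sum_congr rfl fun d _ => ?_
    split_ifs <;> omega
  have hup : (∑ j, if q i < q j ∧ q j ≤ q i + e then (1 : ℤ) else 0) =
      (∑ j, if i < j ∧ (q j < q i + e ∨ (q j = q i + e ∧ q i ∉ beta kap)) then 1 else 0) +
        if q i ∈ beta kap then 1 else 0 := by
    -- The correction is written as a sum over `j`, with the single index at `q i + e` contributing,
    -- so that the two sides can be compared term by term.
    have hone : (if q i ∈ beta kap then (1 : ℤ) else 0) =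
        ∑ j, if q j = q i + e ∧ q i ∈ beta kap then 1 else 0 := by
      by_cases h : q i ∈ beta kap
      · obtain ⟨k, hk⟩ := start_add_mem_range he hook hcore hw h
        simp only [h, if_true, and_true]
        rw [← hq] at hk
        simp [← hk, hmono.injective.eq_iff]
      · simp [h]
    rw [hone, ← Finset.sum_add_distrib]
    refine Finset.sum_congr rfl fun j _ => ?_
    have hlt : q i < q j ↔ i < j := hmono.lt_iff_lt
    by_cases h : q i ∈ beta kap <;> simp only [h, not_true_eq_false, not_false_eq_true, and_true,
      and_false, or_false, if_false] <;> split_ifs <;> omega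
  have hdown : (∑ j, if q i - e < q j ∧ q j ≤ q i then (1 : ℤ) else 0) =
      (∑ j, if j < i ∧ (q i < q j + e ∨ (q i = q j + e ∧ q j ∉ beta kap)) then 1 else 0) + 1 -
        if q i - e ∉ beta kap then 1 else 0 := by
    have hone : (if q i - e ∉ beta kap then (1 : ℤ) else 0) =
        ∑ j, if q i = q j + e ∧ q j ∉ beta kap then 1 else 0 := by
      by_cases h : q i - e ∈ beta kap
      · rw [if_neg (not_not.2 h)]
        refine (Finset.sum_eq_zero fun j _ => if_neg ?_).symm
        rintro ⟨h1, h2⟩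
        rw [h1, add_sub_cancel_right] at h
        exact h2 h
      · obtain ⟨k, hk⟩ := start_sub_mem_range he hook hcore hw h
        rw [← hq] at hk
        rw [if_pos h, Finset.sum_eq_single k]
        · rw [if_pos ⟨by omega, hk ▸ h⟩]
        · intro j _ hj
          refine if_neg fun h1 => hj (hmono.injective ?_)
          omega
        · simp
    have hself : ∀ a : ℤ, a + 1 = a + ∑ j, if q j = q i then 1 else 0 := by
      simp [hmono.injective.eq_iff]
    rw [hone, eq_sub_iff_add_eq, hself, ← Finset.sum_add_distrib, ← Finset.sum_add_distrib]
    refine Finset.sum_congr rfl fun j _ => ?_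
    have hlt : q j < q i ↔ j < i := hmono.lt_iff_lt
    by_cases h : q j ∈ beta kap <;> simp only [h, not_true_eq_false, not_false_eq_true, and_true,
      and_false, or_false, if_false] <;> split_ifs <;> omega
  rw [hd, hup, hdown]
  have := @sub_mem_core _ _ _ he hcore (q i)
  by_cases h1 : q i ∈ beta kap <;> by_cases h2 : q i - e ∈ beta kap <;> simp_all <;> ring

/-- A form vanishes at the starting positions when `q_i` is the first vacancy of its runner or when
`i`, `j` are consecutive on a runner. A runner with `r ≥ 1` movements has one pivot and `r - 1`
consecutive pairs, which matches its `r` edges. -/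
lemma exists_isFrame (he : 0 < e) (hook : IsHookQuotient e lam)
    (hcore : IsCoreOf e kap lam) (hw : eWeight e lam = w) :
    ∃ τ, IsFrame (formVal e kap (start hw)) (formLin e w kap) (baseSel e kap (start hw)) τ
      (zLabel hw) (epsVec hw) := by
  classical
  have hmono := start_strictMono he hook hw
  have he' : (0 : ℤ) < e := by exact_mod_cast he
  choose nxt hnxt using fun i : {i // start hw i ∈ beta kap} =>
    start_add_mem_range he hook hcore hw i.2
  choose prv hprv using fun i : {i // start hw i - e ∉ beta kap} =>
    start_sub_mem_range he hook hcore hw i.2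
  have hnxt_lt : ∀ i h, i < nxt ⟨i, h⟩ := fun i h => by
    rw [← hmono.lt_iff_lt, hnxt ⟨i, h⟩]
    simpa using he
  have hprv_lt : ∀ i h, prv ⟨i, h⟩ < i := fun i h => by
    rw [← hmono.lt_iff_lt, hprv ⟨i, h⟩]
    simpa using he
  -- A consecutive pair is attached to its member farther from the pivot. Past the pivot its form
  -- belongs to the base selection, so the edge is minus the linear part.
  let τ : Fin w → FormIdx e w kap := fun i =>
    if h : start hw i ∈ beta kap then .inr (i, nxt ⟨i, h⟩)
    else if h' : start hw i - e ∈ beta kap then .inl (i, ⟨start hw i, mem_coreVacancies.2 ⟨h, h'⟩⟩)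
    else .inr (prv ⟨i, h'⟩, i)
  have hlow : ∀ i h, τ i = .inr (i, nxt ⟨i, h⟩) := fun i h => dif_pos h
  have hpiv : ∀ i h h', τ i = .inl (i, ⟨start hw i, mem_coreVacancies.2 ⟨h, h'⟩⟩) := fun i h h' => by
    simp only [τ, dif_neg h, dif_pos h']
  have hhigh : ∀ i h, τ i = .inr (prv ⟨i, h⟩, i) := fun i h => by
    simp only [τ, dif_neg (mt (sub_mem_core he hcore) h), dif_neg h]
  have htau : ∀ i, formVal e kap (start hw) (τ i) = 0 ∧
      ((τ i ∈ baseSel e kap (start hw) ∧ epsVec hw i = -formLin e w kap (τ i)) ∨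
        (τ i ∉ baseSel e kap (start hw) ∧ epsVec hw i = formLin e w kap (τ i))) := by
    intro i
    by_cases h : start hw i ∈ beta kap
    · have h1 := hnxt ⟨i, h⟩
      rw [hlow i h, inr_mem_baseSel, epsVec_of_mem_core he hook hcore hw h h1]
      refine ⟨by simp [formVal, hnxt_lt i h, h1], Or.inr ⟨?_, by simp [formLin, hnxt_lt i h]⟩⟩
      rintro ⟨-, h2 | h2⟩
      · exact h2.ne h1
      · exact h2.2 h
    · by_cases h' : start hw i - e ∈ beta kap
      · rw [hpiv i h h', inl_mem_baseSel, epsVec_of_notMem_core he hook hcore hw h h']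
        exact ⟨by simp [formVal], Or.inr ⟨lt_irrefl _, rfl⟩⟩
      · have h1 := hprv ⟨i, h'⟩
        rw [hhigh i h', inr_mem_baseSel, epsVec_of_sub_notMem_core he hook hcore hw h' h1]
        refine ⟨by simp [formVal, hprv_lt i h', h1], Or.inl ⟨⟨hprv_lt i h', Or.inr ⟨?_, ?_⟩⟩, ?_⟩⟩
        · rw [h1, sub_add_cancel]
        · rwa [h1]
        · simp [formLin, hprv_lt i h']
  refine ⟨τ, ?_, zLabel_eq_sum_baseSel he hook hcore hw, fun i => (htau i).1, fun i hi => ?_,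
    fun i hi => ?_, ?_, linearIndependent_epsVec he hook hcore hw⟩
  · rintro (⟨i, d⟩ | ⟨i, j⟩)
    · rw [inl_mem_baseSel]
      simp only [formVal]
      omega
    · rw [inr_mem_baseSel]
      by_cases hij : i < j
      · simp only [formVal, hij, if_true, true_and]
        exact ⟨fun h => Or.inl (by omega), fun h => by omega⟩
      · simp [formVal, hij]
  · rcases (htau i).2 with h | h
    · exact h.2
    · exact absurd hi h.1
  · rcases (htau i).2 with h | h
    · exact absurd h.1 hi
    · exact h.2
  · rintro (⟨i, d, hd⟩ | ⟨i, j⟩) hT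
    · have hd' : start hw i = d := by simpa [formVal, sub_eq_zero] using hT
      subst hd'
      have := mem_coreVacancies.1 hd
      exact ⟨i, hpiv i this.1 this.2⟩
    · by_cases hij : i < j
      · simp only [formVal, hij, if_true] at hT
        by_cases h : start hw i ∈ beta kap
        · refine ⟨i, ?_⟩
          have h1 : nxt ⟨i, h⟩ = j := hmono.injective ((hnxt ⟨i, h⟩).trans (by simp only; omega))
          rw [hlow i h, h1]
        · have h' : start hw j - e ∉ beta kap := by
            rwa [show start hw j - e = start hw i by omega]
          have h1 : prv ⟨j, h'⟩ = i := hmono.injective ((hprv ⟨j, h'⟩).trans (by simp only; omega))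
          exact ⟨j, by rw [hhigh j h', h1]⟩
      · simp [formVal, hij] at hT

/-- The intersection of the parallelotopes of two hook-quotient partitions with the same core and
weight is a face of the first one. -/
lemma isFace_inter {mu : YoungDiagram} (he : 0 < e) (hook : IsHookQuotient e lam)
    (hook' : IsHookQuotient e mu) (hcore : IsCoreOf e kap lam) (hcore' : IsCoreOf e kap mu)
    (hw : eWeight e lam = w) (hw' : eWeight e mu = w) :
    IsFace hw (parallelotope hw ∩ parallelotope hw') := by
  obtain ⟨τ, hf⟩ := exists_isFrame he hook hcore hw
  obtain ⟨τ', hf'⟩ := exists_isFrame he hook' hcore' hw'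
  have h := hf.inter_eq hf' (formVal_sub _ _)
  have hface := hf.isFace_common (formVal e kap (start hw'))
  rw [← h] at hface
  exact hface

end Frames

end Abacus

theorem proposition8p2 (e : ℕ) (he : 2 ≤ e) (kap : YoungDiagram) (w : ℕ) (lam mu : YoungDiagram)
    (hlam : lam ∈ Abacus.block e kap w) (hmu : mu ∈ Abacus.block e kap w)
    (hlam_hook : Abacus.IsHookQuotient e lam) (hmu_hook : Abacus.IsHookQuotient e mu) :
    (∃ F : Set (Fin w → ℤ), Abacus.IsFace hlam.2 F ∧ Abacus.IsFace hmu.2 F ∧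
      Abacus.incPart 4 (Abacus.parallelotope hlam.2) ∩
        Abacus.incPart 4 (Abacus.parallelotope hmu.2) = Abacus.incPart 4 F) ∧
    ((Abacus.IsIncreasing 7 (Abacus.zLabel hlam.2) ∨
        Abacus.IsIncreasing 7 (Abacus.zLabel hmu.2)) →
      Abacus.IsFace hlam.2
          (Abacus.parallelotope hlam.2 ∩ Abacus.parallelotope hmu.2) ∧
        Abacus.IsFace hmu.2
          (Abacus.parallelotope hlam.2 ∩ Abacus.parallelotope hmu.2)) := by
  have he' : 0 < e := by omega
  have hface := Abacus.isFace_inter he' hlam_hook hmu_hook hlam.1 hmu.1 hlam.2 hmu.2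
  have hface' := Abacus.isFace_inter he' hmu_hook hlam_hook hmu.1 hlam.1 hmu.2 hlam.2
  rw [Set.inter_comm] at hface'
  -- The face `F` is the full intersection of the parallelotopes, and taking `4`-increasing parts
  -- commutes with intersections.
  refine ⟨⟨_, hface, hface', ?_⟩, fun _ => ⟨hface, hface'⟩⟩
  ext x
  simp only [Abacus.incPart, Set.mem_inter_iff, Set.mem_ofPred_eq]
  tauto
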